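/- **Setting.** Let $d\in\{1,2\}$. For $d=1$ let $\Omega=(\alpha,\beta)$ be an interval with a subdivision $\mathcal T$ given by $\alpha=a_0<a_1<\dots<a_n=\beta$, with $h_k=a_k-a_{k-1}$. For $d=2$ let $\Omega\subset\mathbb R^2$ be open and let $\mathcal T$ be a finite conforming triangulation of $\overline\Omega$ into nondegenerate closed triangles (two triangles meet in a common, possibly empty, face) such that $\partial\Omega$ is a union of edges of triangles. For a triangle $T$ let $|T|$ be its area and $\theta_{T,1},\theta_{T,2},\theta_{T,3}$ its interior angles; assume that there are $0<t_{\min}\le t_{\max}<\pi/2$ with $t_{\min}\le\theta_{T,k}\le t_{\max}$ for all $T\in\mathcal T$ and $k=1,2,3$. Let $a_1,\dots,a_N$ (renumbered) denote the vertices of $\mathcal T$ that lie in $\Omega$, let $\varphi_1,\dots,\varphi_N$ be the nodal basis functions (continuous, affine on each element, $\varphi_i(a_j)=\delta_{ij}$, and zero at all vertices on $\partial\Omega$), and let $\mathcal V=\operatorname{span}\{\varphi_1,\dots,\varphi_N\}$. Let $b:\Omega\times\mathbb R\to\mathbb R$ be such that $b(\cdot,\eta)$ is measurable for every $\eta\in\mathbb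 R$ and, for a.e. $x\in\Omega$, $b(x,\cdot)$ is $C^1$ with $0\le\frac{\partial b}{\partial\eta}(x,\eta)\le B_\eta$ for all $\eta\in\mathbb R$, with a constant $B_\eta\ge 0$. Let $u_1\in\mathcal V$ be a subsolution and $u_2\in\mathcal V$ a supersolution of the discrete semilinear problem; that is, for every $v\in\mathcal V$ with $v\ge0$ the integrands below are integrable and $$\int_\Omega \nabla u_1\cdot\nabla v+b(x,u_1)\,v\,dx\le 0,\qquad \int_\Omega \nabla u_2\cdot\nabla v+b(x,u_2)\,v\,dx\ge 0 .$$ With $z(t)=t\,u_1+(1-t)\,u_2$ let $A=S+M\in\mathbb R^{N\times N}$ be the matrix with $$s_{ij}=\sum_{T\in\mathcal T}\int_T\nabla\varphi_i\cdot\nabla\varphi_j\,dx,\qquad m_{ij}=\sum_{T\in\mathcal T}\int_T\int_0^1\frac{\partial b}{\partial\eta}(x,z(t))\,\varphi_i\varphi_j\,dt\,dx .$$ **Theorem.** Assume that $$B_\eta\,h_k^2\le 6\quad\text{for } k=1,\dots,n,\ \text{ if } d=1,\qquad\qquad B_\eta\,|T|\le 6\min_{k=1,2,3}\cot\theta_{T,k}\quad\text{for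 each } T\in\mathcal T,\ \text{ if } d=2 .$$ (For $B_\eta>0$ these read $h_k^2\le 6/B_\eta$ and $|T|\le \frac{6}{B_\eta}\min_k\cot\theta_{T,k}$; for $B_\eta=0$ they are no restriction.) Then $A$ is a Stieltjes matrix, i.e. $A$ is symmetric positive definite and $a_{ij}\le 0$ for $i\ne j$. Moreover all entries of $A^{-1}$ are nonnegative, and $u_1\le u_2$ in $\Omega$. -/

import Mathlib

open MeasureTheory

/-- A conforming simplicial partition of the open set `Ω ⊆ E` into finitely many `d`-simplices
(intervals for `d = 1`, triangles for `d = 2`), indexed by `ι`, which exactly captures the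
boundary of `Ω`.  The nondegenerate simplex `T` is given by its `d + 1` affinely independent
vertices `cell T 0, …, cell T d`; `(cell T).coord i` is then the `i`-th barycentric coordinate. -/
structure Mesh {E : Type*} [NormedAddCommGroup E] [InnerProductSpace ℝ E]
    (ι : Type*) (d : ℕ) (Ω : Set E) where
  cell : ι → AffineBasis (Fin (d + 1)) ℝ E
  /-- Different indices belong to different simplices. -/
  cell_injective : Function.Injective fun T => Set.range (cell T)
  /-- Two closed simplices meet in a common (possibly empty) face. -/
  conforming : ∀ S T, convexHull ℝ (Set.range (cell S)) ∩ convexHull ℝ (Set.range (cell T)) =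
    convexHull ℝ (Set.range (cell S) ∩ Set.range (cell T))
  isOpen : IsOpen Ω
  iUnion_eq : ⋃ T, convexHull ℝ (Set.range (cell T)) = closure Ω
  /-- The boundary of `Ω` is a union of faces of codimension one (nodes if `d = 1`, edges if
  `d = 2`) of the partition. -/
  boundary : ∀ x ∈ frontier Ω, ∃ T i, x ∈ convexHull ℝ (cell T '' {i}ᶜ) ∧
    convexHull ℝ (cell T '' {i}ᶜ) ⊆ frontier Ω

namespace Mesh

variable {E : Type*} [NormedAddCommGroup E] [InnerProductSpace ℝ E]
  {ι : Type*} {d : ℕ} {Ω : Set E}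

/-- The closed simplex with index `T`. -/
def elem (M : Mesh ι d Ω) (T : ι) : Set E := convexHull ℝ (Set.range (M.cell T))

/-- The interior vertices of the partition, i.e. the degrees of freedom of the homogeneous
Dirichlet problem. -/
def dof (M : Mesh ι d Ω) : Set E := {a | a ∈ Ω ∧ ∃ T i, M.cell T i = a}

theorem dof_finite [Finite ι] (M : Mesh ι d Ω) : M.dof.Finite := by
  refine (Set.finite_range fun p : ι × Fin (d + 1) => M.cell p.1 p.2).subset ?_
  rintro a ⟨-, T, i, rfl⟩
  exact ⟨(T, i), rfl⟩

noncomputable instance dofFintype [Finite ι] (M : Mesh ι d Ω) : Fintype M.dof :=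
  M.dof_finite.fintype

open Classical in
/-- The nodal basis function of the vertex `a`: on every closed simplex with vertex `a` it is the
barycentric coordinate that belongs to `a`, and it vanishes elsewhere.  The lemmas `hat_vertex`
and `hat_of_notMem` show that the choice of the simplex is immaterial. -/
noncomputable def hat (M : Mesh ι d Ω) (a x : E) : ℝ :=
  if h : ∃ p : ι × Fin (d + 1), M.cell p.1 p.2 = a ∧ x ∈ M.elem p.1 then
    (M.cell h.choose.1).coord h.choose.2 x
  else 0

theorem coord_eq_zero (B : AffineBasis (Fin (d + 1)) ℝ E) {s : Set E} {i : Fin (d + 1)}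
    (hs : s ⊆ Set.range B) (hi : B i ∉ s) {x : E} (hx : x ∈ convexHull ℝ s) :
    B.coord i x = 0 := by
  have h : convexHull ℝ s ⊆ (B.coord i) ⁻¹' {0} := by
    refine convexHull_min ?_ ((convex_singleton 0).affine_preimage _)
    intro y hy
    obtain ⟨j, rfl⟩ := hs hy
    have hij : i ≠ j := by
      rintro rfl
      exact hi hy
    simp [AffineBasis.coord_apply_ne _ hij]
  exact h hx

theorem coord_eq_coord (B C : AffineBasis (Fin (d + 1)) ℝ E) {i j : Fin (d + 1)}
    (hij : B i = C j) {x : E} (hx : x ∈ convexHull ℝ (Set.range B ∩ Set.range C)) :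
    B.coord i x = C.coord j x := by
  have h : convexHull ℝ (Set.range B ∩ Set.range C) ⊆ (B.coord i - C.coord j) ⁻¹' {0} := by
    refine convexHull_min ?_ ((convex_singleton 0).affine_preimage _)
    rintro y ⟨⟨k, rfl⟩, ⟨l, hl⟩⟩
    have hkl : i = k ↔ j = l := by
      constructor
      · rintro rfl
        exact C.ind.injective (hij.symm.trans hl.symm)
      · rintro rfl
        exact B.ind.injective (hij.trans hl)
    have h2 : C.coord j (B k) = if j = l then 1 else 0 := by rw [← hl, AffineBasis.coord_apply]
    have h1 : B.coord i (B k) = if i = k then 1 else 0 := AffineBasis.coord_apply _ _ _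
    simp [h1, h2, hkl]
  exact sub_eq_zero.1 (h hx)

theorem hat_vertex (M : Mesh ι d Ω) (T : ι) (i : Fin (d + 1)) {x : E} (hx : x ∈ M.elem T) :
    M.hat (M.cell T i) x = (M.cell T).coord i x := by
  have h : ∃ p : ι × Fin (d + 1), M.cell p.1 p.2 = M.cell T i ∧ x ∈ M.elem p.1 :=
    ⟨(T, i), rfl, hx⟩
  rw [hat, dif_pos h]
  refine coord_eq_coord _ _ h.choose_spec.1 ?_
  rw [← M.conforming]
  exact ⟨h.choose_spec.2, hx⟩

theorem hat_of_notMem (M : Mesh ι d Ω) (T : ι) {a x : E} (ha : a ∉ Set.range (M.cell T))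
    (hx : x ∈ M.elem T) : M.hat a x = 0 := by
  rw [hat]
  split_ifs with h
  · refine coord_eq_zero (M.cell h.choose.1) Set.inter_subset_left (fun hmem => ?_)
      ((M.conforming h.choose.1 T).subset ⟨h.choose_spec.2, hx⟩)
    rw [h.choose_spec.1] at hmem
    exact ha hmem.2
  · rfl

/-- The `P₁` finite element space with homogeneous Dirichlet conditions: the span of the nodal
basis functions of the interior vertices.  (Its members are functions on all of `E` that vanish
outside `Ω`.) -/
noncomputable def space (M : Mesh ι d Ω) : Submodule ℝ (E → ℝ) :=
  Submodule.span ℝ (M.hat '' M.dof)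

end Mesh

/-- The structural assumption on the lower order term `b(x, η)`, with the bound `Bη` for `∂b/∂η`:
`b` is (Lebesgue) measurable in `x ∈ Ω` for every `η`, and for a.e. `x ∈ Ω` it is `C¹` in `η` with
`0 ≤ ∂b/∂η ≤ Bη`. -/
structure LowerOrderTerm {E : Type*} [NormedAddCommGroup E] [MeasureSpace E]
    (Ω : Set E) (b : E → ℝ → ℝ) (Bη : ℝ) : Prop where
  nonneg : 0 ≤ Bη
  measurable : ∀ η, AEMeasurable (fun x => b x η) (volume.restrict Ω)
  contDiff : ∀ᵐ x ∂(volume.restrict Ω), ContDiff ℝ 1 (b x)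
  deriv_mem : ∀ᵐ x ∂(volume.restrict Ω), ∀ η, 0 ≤ deriv (b x) η ∧ deriv (b x) η ≤ Bη

namespace Mesh

variable {E : Type*} [NormedAddCommGroup E] [InnerProductSpace ℝ E] [CompleteSpace E]
  [MeasureSpace E] {ι : Type*} {d : ℕ} {Ω : Set E}

/-- The integrand `∇u · ∇v + b(x, u) v` of the weak form of `-Δu + b(x, u) = 0`.  For piecewise
affine `u` and `v` the gradients are the classical ones, which exist off the edges. -/
noncomputable def weakIntegrand (b : E → ℝ → ℝ) (u v : E → ℝ) (x : E) : ℝ :=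
  inner ℝ (gradient u x) (gradient v x) + b x (u x) * v x

/-- `u` is a subsolution of the discrete problem: `u` is in the finite element space and the weak
form is (well-defined and) nonpositive for all nonnegative discrete test functions. -/
def IsSubsolution (M : Mesh ι d Ω) (b : E → ℝ → ℝ) (u : E → ℝ) : Prop :=
  u ∈ M.space ∧ ∀ v ∈ M.space, (∀ x ∈ Ω, 0 ≤ v x) →
    IntegrableOn (weakIntegrand b u v) Ω ∧ ∫ x in Ω, weakIntegrand b u v x ≤ 0

/-- `u` is a supersolution of the discrete problem. -/
def IsSupersolution (M : Mesh ι d Ω) (b : E → ℝ → ℝ) (u : E → ℝ) : Prop :=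
  u ∈ M.space ∧ ∀ v ∈ M.space, (∀ x ∈ Ω, 0 ≤ v x) →
    IntegrableOn (weakIntegrand b u v) Ω ∧ 0 ≤ ∫ x in Ω, weakIntegrand b u v x

/-- The stiffness matrix, `s_ij = ∑_T ∫_T ∇φ_i · ∇φ_j dx`. -/
noncomputable def stiffness [Fintype ι] (M : Mesh ι d Ω) : Matrix M.dof M.dof ℝ :=
  Matrix.of fun i j => ∑ T, ∫ x in M.elem T,
    inner ℝ (gradient (M.hat i) x) (gradient (M.hat j) x)

/-- The weighted mass matrix, `m_ij = ∑_T ∫_T ∫_0^1 ∂b/∂η(x, z(t)) φ_i φ_j dt dx` with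
`z(t) = t u₁ + (1 - t) u₂`. -/
noncomputable def mass [Fintype ι] (M : Mesh ι d Ω) (b : E → ℝ → ℝ) (u₁ u₂ : E → ℝ) :
    Matrix M.dof M.dof ℝ :=
  Matrix.of fun i j => ∑ T, ∫ x in M.elem T, ∫ t in (0 : ℝ)..1,
    deriv (b x) (t * u₁ x + (1 - t) * u₂ x) * M.hat i x * M.hat j x

/-- The system matrix `A = S + M` of the linearized problem. -/
noncomputable def systemMatrix [Fintype ι] (M : Mesh ι d Ω) (b : E → ℝ → ℝ) (u₁ u₂ : E → ℝ) :
    Matrix M.dof M.dof ℝ :=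
  M.stiffness + M.mass b u₁ u₂

end Mesh

/-- A Stieltjes matrix is a real symmetric positive definite matrix whose off-diagonal entries are
nonpositive. -/
def IsStieltjes {n : Type*} [Fintype n] (A : Matrix n n ℝ) : Prop :=
  A.IsSymm ∧ A.PosDef ∧ ∀ i j, i ≠ j → A i j ≤ 0

/-- The interval `[a_{k-1}, a_k]` of a subdivision as a one-dimensional simplex. -/
noncomputable def intervalCell {n : ℕ} (a : Fin (n + 1) → ℝ) (ha : StrictMono a) (k : Fin n) :
    AffineBasis (Fin (1 + 1)) ℝ ℝ where
  toFun := ![a k.castSucc, a k.succ]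
  ind' := affineIndependent_of_ne ℝ (ha k.castSucc_lt_succ).ne
  tot' := by
    rw [(affineIndependent_of_ne ℝ (ha k.castSucc_lt_succ).ne).affineSpan_eq_top_iff_card_eq_finrank_add_one]
    simp

theorem range_intervalCell {n : ℕ} (a : Fin (n + 1) → ℝ) (ha : StrictMono a) (k : Fin n) :
    Set.range (intervalCell a ha k) = {a k.castSucc, a k.succ} := by
  change Set.range ![a k.castSucc, a k.succ] = _
  simp [Matrix.range_cons, Set.pair_comm]

theorem convexHull_intervalCell {n : ℕ} (a : Fin (n + 1) → ℝ) (ha : StrictMono a) (k : Fin n) :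
    convexHull ℝ (Set.range (intervalCell a ha k)) = Set.Icc (a k.castSucc) (a k.succ) := by
  rw [range_intervalCell, convexHull_pair, segment_eq_Icc (ha k.castSucc_lt_succ).le]

theorem Icc_inter_Icc_eq_convexHull {p q r s : ℝ} (hpq : p < q) (hqr : q ≤ r) (hrs : r < s) :
    Set.Icc p q ∩ Set.Icc r s = convexHull ℝ ({p, q} ∩ {r, s}) := by
  rcases hqr.eq_or_lt with rfl | h
  · have h1 : ({p, q} ∩ {q, s} : Set ℝ) = {q} := by
      ext x
      simp only [Set.mem_inter_iff, Set.mem_insert_iff, Set.mem_singleton_iff]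
      constructor
      · rintro ⟨rfl | rfl, h | h⟩ <;> linarith
      · rintro rfl
        simp
    rw [h1, convexHull_singleton]
    ext x
    simp only [Set.mem_inter_iff, Set.mem_Icc, Set.mem_singleton_iff]
    constructor
    · rintro ⟨⟨_, _⟩, _, _⟩
      linarith
    · rintro rfl
      exact ⟨⟨hpq.le, le_rfl⟩, le_rfl, hrs.le⟩
  · have h1 : ({p, q} ∩ {r, s} : Set ℝ) = ∅ := by
      ext x
      simp only [Set.mem_inter_iff, Set.mem_insert_iff, Set.mem_singleton_iff,
        Set.mem_empty_iff_false, iff_false]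
      rintro ⟨rfl | rfl, h' | h'⟩ <;> linarith
    rw [h1, convexHull_empty]
    ext x
    simp only [Set.mem_inter_iff, Set.mem_Icc, Set.mem_empty_iff_false, iff_false]
    rintro ⟨⟨_, _⟩, _, _⟩
    linarith

theorem exists_mem_Icc_of_subdivision {n : ℕ} (a : Fin (n + 1) → ℝ) (ha : StrictMono a)
    (h0 : 0 < n) {x : ℝ} (hx : x ∈ Set.Icc (a 0) (a (Fin.last n))) :
    ∃ k : Fin n, x ∈ Set.Icc (a k.castSucc) (a k.succ) := by
  have key : ∀ j : Fin (n + 1), x ≤ a j →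
      x = a 0 ∨ ∃ k : Fin n, x ∈ Set.Icc (a k.castSucc) (a k.succ) := by
    intro j
    induction j using Fin.induction with
    | zero => exact fun h => Or.inl (le_antisymm h hx.1)
    | succ k ih =>
      intro h
      rcases le_total x (a k.castSucc) with h' | h'
      · exact ih h'
      · exact Or.inr ⟨k, h', h⟩
  rcases key _ hx.2 with rfl | h
  · exact ⟨⟨0, h0⟩, le_rfl, ha.monotone (Fin.zero_le _)⟩
  · exact h

/-- The subdivision `α = a₀ < a₁ < … < a_n = β` of the interval `(α, β)`. -/
noncomputable def intervalMesh {n : ℕ} (a : Fin (n + 1) → ℝ) (ha : StrictMono a) :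
    Mesh (Fin n) 1 (Set.Ioo (a 0) (a (Fin.last n))) where
  cell := intervalCell a ha
  cell_injective := by
    intro S T h
    have h' : Set.Icc (a S.castSucc) (a S.succ) = Set.Icc (a T.castSucc) (a T.succ) := by
      rw [← convexHull_intervalCell a ha, ← convexHull_intervalCell a ha]
      exact congrArg (convexHull ℝ) h
    have h1 := ((Set.Icc_eq_Icc_iff (ha S.castSucc_lt_succ).le).1 h').1
    exact Fin.castSucc_injective n (ha.injective h1)
  conforming := by
    intro S T
    rcases lt_trichotomy S T with h | rfl | h
    · rw [convexHull_intervalCell, convexHull_intervalCell, range_intervalCell,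
        range_intervalCell]
      exact Icc_inter_Icc_eq_convexHull (ha S.castSucc_lt_succ)
        (ha.monotone (Fin.succ_le_castSucc_iff.2 h)) (ha T.castSucc_lt_succ)
    · simp
    · rw [convexHull_intervalCell, convexHull_intervalCell, range_intervalCell,
        range_intervalCell, Set.inter_comm, Set.inter_comm {a S.castSucc, a S.succ}]
      exact Icc_inter_Icc_eq_convexHull (ha T.castSucc_lt_succ)
        (ha.monotone (Fin.succ_le_castSucc_iff.2 h)) (ha S.castSucc_lt_succ)
  isOpen := isOpen_Ioo
  iUnion_eq := by
    simp only [convexHull_intervalCell]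
    rcases Nat.eq_zero_or_pos n with rfl | h0
    · simp
    · rw [closure_Ioo (ha (by simpa [Fin.lt_def] using h0)).ne]
      ext x
      rw [Set.mem_iUnion]
      constructor
      · rintro ⟨k, hk⟩
        exact ⟨(ha.monotone (Fin.zero_le _)).trans hk.1,
          hk.2.trans (ha.monotone (Fin.le_last _))⟩
      · exact exists_mem_Icc_of_subdivision a ha h0
  boundary := by
    intro x hx
    rcases n with _ | n
    · simp at hx
    · have hlt : a 0 < a (Fin.last (n + 1)) := ha (by simp [Fin.lt_def])
      have hc0 : ({1}ᶜ : Set (Fin (1 + 1))) = {0} := by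
        ext i
        fin_cases i <;> simp
      have hc1 : ({0}ᶜ : Set (Fin (1 + 1))) = {1} := by
        ext i
        fin_cases i <;> simp
      rw [frontier_Ioo hlt] at hx ⊢
      rcases hx with rfl | hx
      · refine ⟨0, 1, ?_⟩
        have h : intervalCell a ha 0 0 = a 0 := rfl
        rw [hc0, Set.image_singleton, convexHull_singleton, h]
        simp
      · rw [Set.mem_singleton_iff] at hx
        subst hx
        refine ⟨Fin.last n, 0, ?_⟩
        have h : intervalCell a ha (Fin.last n) 1 = a (Fin.last (n + 1)) := rfl
        rw [hc1, Set.image_singleton, convexHull_singleton, h]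
        simp

/-- The interior angle of the triangle `T` at its vertex `k`. -/
noncomputable def triangleAngle
    (T : AffineBasis (Fin 3) ℝ (EuclideanSpace ℝ (Fin 2))) (k : Fin 3) : ℝ :=
  EuclideanGeometry.angle (T (k + 1)) (T k) (T (k + 2))

/-- Mesh regularity: the angles are bounded away from `0` and from `π / 2`. -/
def MeshRegular {ι : Type*} {Ω : Set (EuclideanSpace ℝ (Fin 2))} (M : Mesh ι 2 Ω) : Prop :=
  ∃ tmin tmax : ℝ, 0 < tmin ∧ tmin ≤ tmax ∧ tmax < Real.pi / 2 ∧
    ∀ T k, tmin ≤ triangleAngle (M.cell T) k ∧ triangleAngle (M.cell T) k ≤ tmax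

/-! Averaging `∂b/∂η` along the segment from `u₂` to `u₁` gives a coefficient `c(x) = meanDeriv b u₁
u₂ x` with `0 ≤ c ≤ Bη` and `c (u₁ - u₂) = b(x, u₁) - b(x, u₂)`. Hence `A` is the Galerkin matrix of
the linear form `∫ ∇f · ∇g + c f g`, and testing the sub- and supersolution inequalities with the
nodal functions says that `A (w₂ - w₁) ≥ 0` for the vectors of nodal values.

Symmetry is visible from the form. Definiteness comes from the Dirichlet part alone: a discrete
function with vanishing gradient is constant on each simplex, continuous, and zero outside `Ω`,
hence zero (`interp_eq_zero_of_gradient`). The mesh condition is needed only for the off-diagonal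
signs. On one simplex `c` may be replaced by its upper bound, because products of nodal functions
are nonnegative; what remains is an explicit inequality for barycentric coordinates
(`LocalCondition`). On an interval of length `h` it reads `-1/h + B h/6 ≤ 0`; on a triangle, for the
edge opposite the angle `θ`, it reads `-cot θ / 2 + B |T| / 12 ≤ 0`.

A Stieltjes matrix is inverse-monotone (`IsStieltjes.nonneg_of_mulVec_nonneg`, by testing with the
negative part). Applied to the columns of `A⁻¹` this gives `A⁻¹ ≥ 0`; applied to `w₂ - w₁` it gives
`u₁ ≤ u₂`. -/

namespace Mesh

/-! ### Simplices and nodal basis functions -/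

variable {E : Type*} [NormedAddCommGroup E] [InnerProductSpace ℝ E]
  {ι : Type*} {d : ℕ} {Ω : Set E}

theorem elem_isCompact (M : Mesh ι d Ω) (T : ι) : IsCompact (M.elem T) :=
  (Set.finite_range (M.cell T)).isCompact_convexHull ℝ

theorem convex_elem (M : Mesh ι d Ω) (T : ι) : Convex ℝ (M.elem T) := convex_convexHull ℝ _

theorem interior_elem (M : Mesh ι d Ω) (T : ι) :
    interior (M.elem T) = {x | ∀ i, 0 < (M.cell T).coord i x} :=
  (M.cell T).interior_convexHull

theorem elem_eq (M : Mesh ι d Ω) (T : ι) :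
    M.elem T = {x | ∀ i, 0 ≤ (M.cell T).coord i x} :=
  (M.cell T).convexHull_eq_nonneg_coord

theorem elem_subset (M : Mesh ι d Ω) (T : ι) : M.elem T ⊆ closure Ω := by
  rw [← M.iUnion_eq]
  exact Set.subset_iUnion (fun T => convexHull ℝ (Set.range (M.cell T))) T

/-- A point in the interior of a simplex belongs to no other simplex. -/
theorem eq_of_mem_interior (M : Mesh ι d Ω) {S T : ι} {x : E} (hS : x ∈ interior (M.elem S))
    (hT : x ∈ M.elem T) : S = T := by
  have hx := (M.conforming S T).subset ⟨interior_subset hS, hT⟩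
  rw [interior_elem] at hS
  -- A vertex of `S` that is not shared with `T` would make its barycentric coordinate vanish at
  -- `x`, but at interior points all coordinates are positive.
  have hsub : Set.range (M.cell S) ⊆ Set.range (M.cell T) := by
    rintro _ ⟨i, rfl⟩
    by_contra h
    have := coord_eq_zero (M.cell S) Set.inter_subset_left (i := i) (fun h' => h h'.2) hx
    exact (hS i).ne' this
  refine M.cell_injective ?_
  refine Set.eq_of_subset_of_ncard_le hsub ?_ (Set.finite_range _)
  rw [← Nat.card_coe_set_eq, ← Nat.card_coe_set_eq,
    Nat.card_range_of_injective (M.cell T).ind.injective,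
    Nat.card_range_of_injective (M.cell S).ind.injective]

/-- Otherwise the point would be on the frontier, hence on a face of some simplex. That simplex can
only be `T` itself, and on a face of `T` the coordinate of the opposite vertex is zero. -/
theorem interior_elem_subset (M : Mesh ι d Ω) (T : ι) : interior (M.elem T) ⊆ Ω := by
  intro x hx
  by_contra h
  have hf : x ∈ frontier Ω := by
    rw [M.isOpen.frontier_eq]
    exact ⟨M.elem_subset T (interior_subset hx), h⟩
  obtain ⟨S, i, hS, -⟩ := M.boundary x hf
  obtain rfl := M.eq_of_mem_interior hx (convexHull_mono (Set.image_subset_range _ _) hS)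
  have h0 : (M.cell T).coord i x = 0 := by
    refine coord_eq_zero (M.cell T) (Set.image_subset_range _ _) ?_ hS
    rintro ⟨j, hj, hij⟩
    exact hj ((M.cell T).ind.injective hij)
  rw [interior_elem] at hx
  exact (hx i).ne' h0

theorem hat_nonneg (M : Mesh ι d Ω) (a x : E) : 0 ≤ M.hat a x := by
  rw [hat]
  split_ifs with h
  · have := h.choose_spec.2
    rw [elem_eq] at this
    exact this _
  · rfl

/-- A frontier point lies on a face contained in the frontier. Since `a` is in the open set `Ω`, it
is not a vertex of that face, so its coordinate vanishes there. -/
theorem hat_eq_zero (M : Mesh ι d Ω) {a x : E} (ha : a ∈ M.dof) (hx : x ∉ Ω) :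
    M.hat a x = 0 := by
  by_cases hc : x ∈ closure Ω
  · have hf : x ∈ frontier Ω := by
      rw [M.isOpen.frontier_eq]
      exact ⟨hc, hx⟩
    obtain ⟨S, i, hS, hsub⟩ := M.boundary x hf
    have hxS : x ∈ M.elem S := convexHull_mono (Set.image_subset_range _ _) hS
    by_cases haS : a ∈ Set.range (M.cell S)
    · obtain ⟨k, rfl⟩ := haS
      rw [M.hat_vertex S k hxS]
      refine coord_eq_zero (M.cell S) (Set.image_subset_range _ _) (fun hk => ?_) hS
      have := hsub (subset_convexHull ℝ _ hk)
      rw [M.isOpen.frontier_eq] at this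
      exact this.2 ha.1
    · exact M.hat_of_notMem S haS hxS
  · rw [hat, dif_neg]
    rintro ⟨p, -, hp⟩
    exact hc (M.elem_subset _ hp)

theorem mem_elem_or (M : Mesh ι d Ω) (x : E) : x ∉ Ω ∨ ∃ T, x ∈ M.elem T := by
  by_cases h : x ∈ Ω
  · right
    have := subset_closure h
    rw [← M.iUnion_eq] at this
    exact Set.mem_iUnion.1 this
  · exact Or.inl h

open Classical in
/-- The affine function that agrees with the nodal basis function of `a` on the simplex `T`. -/
noncomputable def shape (M : Mesh ι d Ω) (T : ι) (a : E) : E →ᵃ[ℝ] ℝ :=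
  if h : ∃ k, M.cell T k = a then (M.cell T).coord h.choose else 0

theorem shape_vertex (M : Mesh ι d Ω) (T : ι) (k : Fin (d + 1)) :
    M.shape T (M.cell T k) = (M.cell T).coord k := by
  have h : ∃ l, M.cell T l = M.cell T k := ⟨k, rfl⟩
  rw [shape, dif_pos h, (M.cell T).ind.injective h.choose_spec]

theorem shape_of_notMem (M : Mesh ι d Ω) (T : ι) {a : E} (ha : a ∉ Set.range (M.cell T)) :
    M.shape T a = 0 :=
  dif_neg ha

theorem hat_eq_shape (M : Mesh ι d Ω) (T : ι) (a : E) {x : E} (hx : x ∈ M.elem T) :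
    M.hat a x = M.shape T a x := by
  by_cases ha : a ∈ Set.range (M.cell T)
  · obtain ⟨k, rfl⟩ := ha
    rw [shape_vertex, M.hat_vertex T k hx]
  · rw [M.hat_of_notMem T ha hx, M.shape_of_notMem T ha]
    rfl

theorem shape_self (M : Mesh ι d Ω) {a b : E} (T : ι) (k : Fin (d + 1)) (hb : M.cell T k = b)
    [Decidable (a = b)] : M.shape T a b = if a = b then 1 else 0 := by
  subst hb
  split_ifs with h
  · rw [h, shape_vertex, AffineBasis.coord_apply_eq]
  · by_cases ha : a ∈ Set.range (M.cell T)
    · obtain ⟨l, rfl⟩ := ha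
      rw [shape_vertex, AffineBasis.coord_apply_ne]
      rintro rfl
      exact h rfl
    · rw [M.shape_of_notMem T ha]
      rfl

/-! ### Continuity and piecewise constant gradients -/

section Topology

variable [FiniteDimensional ℝ E]

theorem continuous_hat [Finite ι] (M : Mesh ι d Ω) {a : E} (ha : a ∈ M.dof) :
    Continuous (M.hat a) := by
  -- A finite closed cover of the whole space: the complement of `Ω`, where the function is zero,
  -- and the simplices, where it is affine.
  let f : Option ι → Set E := fun o => o.elim Ωᶜ M.elem
  have hf : LocallyFinite f := locallyFinite_of_finite f
  refine hf.continuous ?_ ?_ ?_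
  · refine Set.eq_univ_of_forall fun x => ?_
    rcases M.mem_elem_or x with h | ⟨T, h⟩
    · exact Set.mem_iUnion.2 ⟨none, h⟩
    · exact Set.mem_iUnion.2 ⟨some T, h⟩
  · rintro (_ | T)
    · exact M.isOpen.isClosed_compl
    · exact (M.elem_isCompact T).isClosed
  · rintro (_ | T)
    · exact (continuousOn_const (c := (0 : ℝ))).congr fun x hx => M.hat_eq_zero ha hx
    · exact ((M.shape T a).continuous_of_finiteDimensional.continuousOn).congr
        fun x hx => M.hat_eq_shape T a hx

variable [CompleteSpace E]

/-- The (constant) gradient of an affine function. -/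
noncomputable def affineGradient (f : E →ᵃ[ℝ] ℝ) : E :=
  (InnerProductSpace.toDual ℝ E).symm (LinearMap.toContinuousLinearMap f.linear)

theorem inner_affineGradient (f : E →ᵃ[ℝ] ℝ) (v : E) :
    inner ℝ (affineGradient f) v = f.linear v := by
  simp [affineGradient]

theorem affineGradient_zero : affineGradient (0 : E →ᵃ[ℝ] ℝ) = 0 := by
  refine ext_inner_right ℝ fun v => ?_
  rw [inner_affineGradient]
  simp

theorem hasGradientAt_affine (f : E →ᵃ[ℝ] ℝ) (x : E) : HasGradientAt f (affineGradient f) x := by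
  rw [hasGradientAt_iff_hasFDerivAt, affineGradient, LinearIsometryEquiv.apply_symm_apply]
  have h : (f : E → ℝ) = fun y => LinearMap.toContinuousLinearMap f.linear y + f 0 := by
    ext y
    have := f.linearMap_vsub y 0
    simp at this
    simp [this]
  rw [h]
  exact (ContinuousLinearMap.hasFDerivAt _).add_const _

theorem hasGradientAt_hat (M : Mesh ι d Ω) (T : ι) (a : E) {x : E}
    (hx : x ∈ interior (M.elem T)) :
    HasGradientAt (M.hat a) (affineGradient (M.shape T a)) x := by
  refine (hasGradientAt_affine (M.shape T a) x).congr_of_eventuallyEq ?_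
  filter_upwards [mem_interior_iff_mem_nhds.1 hx] with y hy
  exact M.hat_eq_shape T a hy

end Topology

/-! ### Splitting integrals over the simplices -/

section Measure

variable [FiniteDimensional ℝ E] [MeasureSpace E] [BorelSpace E]
  [(volume : Measure E).IsAddHaarMeasure]

theorem volume_frontier_elem (M : Mesh ι d Ω) (T : ι) : volume (frontier (M.elem T)) = 0 :=
  (M.convex_elem T).addHaar_frontier _

theorem elem_ae_eq_interior (M : Mesh ι d Ω) (T : ι) :
    (interior (M.elem T) : Set E) =ᵐ[volume] M.elem T :=
  interior_ae_eq_of_null_frontier (M.volume_frontier_elem T)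

theorem ae_mem_interior (M : Mesh ι d Ω) (T : ι) :
    ∀ᵐ x ∂volume.restrict (M.elem T), x ∈ interior (M.elem T) := by
  rw [← Measure.restrict_congr_set (M.elem_ae_eq_interior T)]
  exact ae_restrict_mem isOpen_interior.measurableSet

theorem restrict_elem_le (M : Mesh ι d Ω) (T : ι) :
    volume.restrict (M.elem T) ≤ volume.restrict Ω := by
  rw [← Measure.restrict_congr_set (M.elem_ae_eq_interior T)]
  exact Measure.restrict_mono_set _ (M.interior_elem_subset T)

theorem iUnion_interior_ae_eq [Finite ι] (M : Mesh ι d Ω) :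
    (⋃ T, interior (M.elem T) : Set E) =ᵐ[volume] Ω := by
  have h1 : (⋃ T, interior (M.elem T) : Set E) =ᵐ[volume] ⋃ T, M.elem T :=
    Filter.EventuallyEq.countable_iUnion fun T => M.elem_ae_eq_interior T
  have h2 : (⋃ T, interior (M.elem T)) ⊆ Ω := Set.iUnion_subset M.interior_elem_subset
  refine Filter.EventuallyLE.antisymm h2.eventuallyLE ?_
  refine Filter.EventuallyLE.trans ?_ h1.symm.le
  refine (show Ω ⊆ ⋃ T, M.elem T from ?_).eventuallyLE
  exact fun x hx => Set.mem_iUnion.2 ((M.mem_elem_or x).resolve_left (not_not.2 hx))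

/-- Closed simplices overlap in faces, open ones are disjoint, and the two differ by null sets
because frontiers of convex sets are null. -/
theorem restrict_eq_sum [Fintype ι] (M : Mesh ι d Ω) :
    volume.restrict Ω = ∑ T, volume.restrict (M.elem T) := by
  rw [← Measure.restrict_congr_set M.iUnion_interior_ae_eq, Measure.restrict_iUnion,
    Measure.sum_fintype]
  · exact Finset.sum_congr rfl fun T _ => Measure.restrict_congr_set (M.elem_ae_eq_interior T)
  · intro S T hST
    refine Set.disjoint_left.2 fun x hS hT => hST ?_
    exact M.eq_of_mem_interior hS (interior_subset hT)
  · exact fun T => isOpen_interior.measurableSet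

theorem ae_restrict_iff [Fintype ι] (M : Mesh ι d Ω) {p : E → Prop} :
    (∀ᵐ x ∂volume.restrict Ω, p x) ↔ ∀ T, ∀ᵐ x ∂volume.restrict (M.elem T), p x := by
  rw [M.restrict_eq_sum, ← Measure.sum_fintype, Measure.ae_sum_iff]

theorem ae_exists_mem_interior [Fintype ι] (M : Mesh ι d Ω) :
    ∀ᵐ x ∂volume.restrict Ω, ∃ T, x ∈ interior (M.elem T) := by
  rw [M.ae_restrict_iff]
  exact fun T => (M.ae_mem_interior T).mono fun x hx => ⟨T, hx⟩

theorem integrableOn_iff [Fintype ι] (M : Mesh ι d Ω) {f : E → ℝ} :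
    IntegrableOn f Ω ↔ ∀ T, IntegrableOn f (M.elem T) := by
  simp only [IntegrableOn]
  rw [M.restrict_eq_sum, integrable_finsetSum_measure]
  simp

theorem setIntegral_eq_sum [Fintype ι] (M : Mesh ι d Ω) {f : E → ℝ} (hf : IntegrableOn f Ω) :
    ∫ x in Ω, f x = ∑ T, ∫ x in M.elem T, f x := by
  have := M.integrableOn_iff.1 hf
  rw [M.restrict_eq_sum, integral_finsetSum_measure fun T _ => this T]

end Measure

end Mesh

/-! ### Measurability in x and the averaged derivative -/

section Caratheodory

variable {α : Type*} [MeasurableSpace α] {μ : Measure α} {b : α → ℝ → ℝ}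

/-- A function that is a.e. measurable in `x` and for a.e. `x` of class `C¹` in `η` agrees, off a
null set of `x`, with one that has these properties everywhere. -/
theorem exists_measurable_contDiff_version (hb : ∀ η, AEMeasurable (fun x => b x η) μ)
    (hc : ∀ᵐ x ∂μ, ContDiff ℝ 1 (b x)) :
    ∃ b' : α → ℝ → ℝ, (∀ η, Measurable fun x => b' x η) ∧ (∀ x, ContDiff ℝ 1 (b' x)) ∧
      ∀ᵐ x ∂μ, b' x = b x := by
  classical
  have hq : ∀ᵐ x ∂μ, ∀ q : ℚ, b x q = (hb q).mk _ x := ae_all_iff.2 fun q => (hb q).ae_eq_mk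
  have hgood : ∀ᵐ x ∂μ, ContDiff ℝ 1 (b x) ∧ ∀ q : ℚ, b x q = (hb q).mk _ x := hc.and hq
  -- The exceptional set need not be measurable, so it is enlarged to a measurable null set on which
  -- the function can be redefined as zero.
  set s := toMeasurable μ {x | ¬ (ContDiff ℝ 1 (b x) ∧ ∀ q : ℚ, b x q = (hb q).mk _ x)} with hs
  have hsm : MeasurableSet s := measurableSet_toMeasurable _ _
  have hs0 : μ s = 0 := by rw [hs, measure_toMeasurable]; exact hgood
  have hns : ∀ x, x ∉ s → ContDiff ℝ 1 (b x) ∧ ∀ q : ℚ, b x q = (hb q).mk _ x := by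
    intro x hx
    by_contra h
    exact hx (subset_toMeasurable _ _ h)
  let b' : α → ℝ → ℝ := fun x => if x ∈ s then fun _ => 0 else b x
  have hcd : ∀ x, ContDiff ℝ 1 (b' x) := by
    intro x
    by_cases hx : x ∈ s
    · simp only [b', if_pos hx]
      exact contDiff_const
    · simp only [b', if_neg hx]
      exact (hns x hx).1
  have hqm : ∀ q : ℚ, Measurable fun x => b' x q := by
    intro q
    have h : (fun x => b' x q) = fun x => if x ∈ s then 0 else (hb q).mk _ x := by
      ext x
      by_cases hx : x ∈ s
      · simp only [b', if_pos hx]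
      · simp only [b', if_neg hx]
        exact (hns x hx).2 q
    rw [h]
    exact Measurable.ite hsm measurable_const (hb q).measurable_mk
  refine ⟨b', fun η => ?_, hcd, ?_⟩
  -- Only the null sets of the countably many rational `η` were discarded; a real `η` is reached by
  -- continuity in `η`.
  · obtain ⟨q, -, -, hq⟩ := Real.exists_seq_rat_strictMono_tendsto η
    refine measurable_of_tendsto_metrizable (fun n => hqm (q n)) (tendsto_pi_nhds.2 fun x => ?_)
    exact ((hcd x).continuous.tendsto η).comp hq
  · filter_upwards [measure_eq_zero_iff_ae_notMem.1 hs0] with x hx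
    simp only [b', if_neg hx]

/-- The derivative is the pointwise limit of the measurable difference quotients with step `1 / (n +
1)`. -/
theorem measurable_deriv_apply (hb : ∀ η, Measurable fun x => b x η)
    (hc : ∀ x, ContDiff ℝ 1 (b x)) (η : ℝ) : Measurable fun x => deriv (b x) η := by
  have ht : Filter.Tendsto (fun n : ℕ => 1 / ((n : ℝ) + 1)) Filter.atTop (nhdsWithin 0 {0}ᶜ) := by
    refine tendsto_nhdsWithin_iff.2 ⟨tendsto_one_div_add_atTop_nhds_zero_nat, ?_⟩
    filter_upwards with n
    have : (0 : ℝ) < 1 / ((n : ℝ) + 1) := by positivity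
    exact this.ne'
  refine measurable_of_tendsto_metrizable
    (f := fun (n : ℕ) x => (1 / ((n : ℝ) + 1))⁻¹ • (b x (η + 1 / ((n : ℝ) + 1)) - b x η))
    (fun n => ((hb (η + 1 / ((n : ℝ) + 1))).sub (hb η)).const_smul (1 / ((n : ℝ) + 1))⁻¹)
    (tendsto_pi_nhds.2 fun x => ?_)
  have hd : HasDerivAt (b x) (deriv (b x) η) η :=
    ((hc x).differentiable one_ne_zero η).hasDerivAt
  exact (hasDerivAt_iff_tendsto_slope_zero.1 hd).comp ht

end Caratheodory

/-- The mean `∫₀¹ ∂b/∂η(x, t u₁ + (1 - t) u₂) dt` of the derivative between `u₂` and `u₁`. -/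
noncomputable def meanDeriv {α : Type*} (b : α → ℝ → ℝ) (u₁ u₂ : α → ℝ) (x : α) : ℝ :=
  ∫ t in (0 : ℝ)..1, deriv (b x) (t * u₁ x + (1 - t) * u₂ x)

/-- After modification on a null set the derivative is measurable in `x` and continuous in `η`,
hence jointly measurable, and integrating out `t` preserves measurability. -/
theorem aemeasurable_meanDeriv {α : Type*} [MeasurableSpace α] {μ : Measure α} {b : α → ℝ → ℝ}
    (hb : ∀ η, AEMeasurable (fun x => b x η) μ) (hc : ∀ᵐ x ∂μ, ContDiff ℝ 1 (b x))
    {u₁ u₂ : α → ℝ} (h₁ : Measurable u₁) (h₂ : Measurable u₂) :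
    AEMeasurable (meanDeriv b u₁ u₂) μ := by
  obtain ⟨b', hb', hc', he⟩ := exists_measurable_contDiff_version hb hc
  refine ⟨meanDeriv b' u₁ u₂, ?_, ?_⟩
  · have hj : Measurable (Function.uncurry fun η x => deriv (b' x) η) :=
      measurable_uncurry_of_continuous_of_measurable
        (fun x => (hc' x).continuous_deriv le_rfl) (measurable_deriv_apply hb' hc')
    have hm : Measurable fun p : α × ℝ =>
        deriv (b' p.1) (p.2 * u₁ p.1 + (1 - p.2) * u₂ p.1) := by
      refine hj.comp (f := fun p : α × ℝ => (p.2 * u₁ p.1 + (1 - p.2) * u₂ p.1, p.1)) ?_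
      fun_prop
    have : meanDeriv b' u₁ u₂ = fun x => ∫ t in Set.Ioc (0 : ℝ) 1,
        deriv (b' x) (t * u₁ x + (1 - t) * u₂ x) := by
      ext x
      rw [meanDeriv, intervalIntegral.integral_of_le zero_le_one]
    rw [this]
    exact (hm.stronglyMeasurable.integral_prod_right').measurable
  · filter_upwards [he] with x hx
    rw [meanDeriv, meanDeriv, hx]

theorem meanDeriv_nonneg {α : Type*} {b : α → ℝ → ℝ} {x : α} (h : ∀ η, 0 ≤ deriv (b x) η)
    (u₁ u₂ : α → ℝ) : 0 ≤ meanDeriv b u₁ u₂ x :=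
  intervalIntegral.integral_nonneg zero_le_one fun _ _ => h _

theorem meanDeriv_le {α : Type*} {b : α → ℝ → ℝ} {x : α} {B : ℝ} (hc : ContDiff ℝ 1 (b x))
    (h : ∀ η, deriv (b x) η ≤ B) (u₁ u₂ : α → ℝ) : meanDeriv b u₁ u₂ x ≤ B := by
  have hd := hc.continuous_deriv le_rfl
  calc meanDeriv b u₁ u₂ x ≤ ∫ _ in (0 : ℝ)..1, B := by
        refine intervalIntegral.integral_mono_on zero_le_one ?_ (by simp) fun _ _ => h _
        exact Continuous.intervalIntegrable (by fun_prop) _ _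
    _ = B := by simp

/-- The fundamental theorem of calculus on the segment from `u₂ x` to `u₁ x`. This identity makes
the difference of the two nonlinear problems linear in `u₁ - u₂`. -/
theorem meanDeriv_mul_sub {α : Type*} {b : α → ℝ → ℝ} {x : α} (hc : ContDiff ℝ 1 (b x))
    (u₁ u₂ : α → ℝ) :
    meanDeriv b u₁ u₂ x * (u₁ x - u₂ x) = b x (u₁ x) - b x (u₂ x) := by
  have hd := hc.continuous_deriv le_rfl
  have hder : ∀ t : ℝ, HasDerivAt (fun t => b x (t * u₁ x + (1 - t) * u₂ x))
      (deriv (b x) (t * u₁ x + (1 - t) * u₂ x) * (u₁ x - u₂ x)) t := by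
    intro t
    have h1 : HasDerivAt (b x) (deriv (b x) (t * u₁ x + (1 - t) * u₂ x))
        (t * u₁ x + (1 - t) * u₂ x) := (hc.differentiable one_ne_zero _).hasDerivAt
    have h2 : HasDerivAt (fun t => t * u₁ x + (1 - t) * u₂ x) (u₁ x - u₂ x) t := by
      have h3 := ((hasDerivAt_id t).mul_const (u₁ x)).add
        (((hasDerivAt_id t).const_sub 1).mul_const (u₂ x))
      convert! h3 using 1
      ring
    exact h1.comp t h2
  have := intervalIntegral.integral_eq_sub_of_hasDerivAt (a := 0) (b := 1) (fun t _ => hder t)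
    (Continuous.intervalIntegrable (by fun_prop) _ _)
  rw [intervalIntegral.integral_mul_const] at this
  rw [meanDeriv, this]
  simp

/-! ### Inverse monotonicity of Stieltjes matrices -/

open Matrix in
/-- A vector with nonnegative image under a Stieltjes matrix is nonnegative. -/
theorem IsStieltjes.nonneg_of_mulVec_nonneg {n : Type*} [Fintype n] {A : Matrix n n ℝ}
    (hA : IsStieltjes A) {x : n → ℝ} (hx : ∀ i, 0 ≤ (A *ᵥ x) i) (i : n) : 0 ≤ x i := by
  obtain ⟨-, hpos, hoff⟩ := hA
  -- `y` is the negative part of `x`, and `x + y` the positive part. Their supports are disjoint, so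
  -- only off-diagonal entries enter `y · A(x + y)`, which is therefore nonpositive. With `y · A x ≥
  -- 0` this contradicts `y · A y > 0`.
  set y : n → ℝ := fun i => max (-x i) 0 with hy
  have hy0 : ∀ i, 0 ≤ y i := fun i => le_max_right _ _
  by_cases h0 : y = 0
  · have := congrFun h0 i
    simpa [hy] using this
  · exfalso
    have h1 : 0 < y ⬝ᵥ (A *ᵥ y) := by simpa using hpos.dotProduct_mulVec_pos h0
    have h2 : 0 ≤ y ⬝ᵥ (A *ᵥ x) :=
      Finset.sum_nonneg fun i _ => mul_nonneg (hy0 i) (hx i)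
    have h3 : y ⬝ᵥ (A *ᵥ (x + y)) ≤ 0 := by
      simp only [dotProduct, mulVec, Finset.mul_sum]
      refine Finset.sum_nonpos fun i _ => Finset.sum_nonpos fun j _ => ?_
      have hz : 0 ≤ (x + y) j := by
        have := le_max_left (-x j) 0
        simp only [Pi.add_apply, hy]
        linarith
      by_cases hij : i = j
      · subst hij
        have : y i * (x + y) i = 0 := by
          simp only [Pi.add_apply, hy]
          rcases le_total (-x i) 0 with h | h
          · simp [max_eq_right h]
          · simp [max_eq_left h]
        rw [mul_left_comm, this, mul_zero]
      · have := mul_nonneg (hy0 i) hz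
        rw [mul_left_comm]
        exact mul_nonpos_of_nonpos_of_nonneg (hoff i j hij) this
    rw [mulVec_add, dotProduct_add] at h3
    linarith

-- The image under `A` of a column of `A⁻¹` is a standard unit vector, which is nonnegative.
open Matrix in
theorem IsStieltjes.inv_nonneg {n : Type*} [Fintype n] [DecidableEq n] {A : Matrix n n ℝ}
    (hA : IsStieltjes A) (i j : n) : 0 ≤ A⁻¹ i j := by
  have hu : IsUnit A.det := isUnit_iff_ne_zero.2 hA.2.1.det_pos.ne'
  refine hA.nonneg_of_mulVec_nonneg (x := fun i => A⁻¹ i j) (fun k => ?_) i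
  have : (A *ᵥ fun i => A⁻¹ i j) k = (A * A⁻¹) k j := rfl
  rw [this, mul_nonsing_inv A hu, Matrix.one_apply]
  split_ifs <;> norm_num

/-! ### The linearized form, its matrix and the comparison principle -/

namespace Mesh

variable {E : Type*} [NormedAddCommGroup E] [InnerProductSpace ℝ E]
  {ι : Type*} {d : ℕ} {Ω : Set E}

/-- The finite element function with the nodal values `w`. -/
noncomputable def interp [Finite ι] (M : Mesh ι d Ω) (w : M.dof → ℝ) (x : E) : ℝ :=
  ∑ i, w i * M.hat i x

theorem exists_interp_of_mem_space [Finite ι] (M : Mesh ι d Ω) {u : E → ℝ} (hu : u ∈ M.space) :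
    ∃ w, u = M.interp w := by
  rw [space, Set.image_eq_range] at hu
  obtain ⟨w, rfl⟩ := (Submodule.mem_span_range_iff_exists_fun ℝ).1 hu
  refine ⟨w, ?_⟩
  ext x
  simp [interp]

theorem interp_vertex [Finite ι] (M : Mesh ι d Ω) (w : M.dof → ℝ) (a : M.dof) :
    M.interp w a = w a := by
  classical
  obtain ⟨T, k, hk⟩ := a.2.2
  have hT : (a : E) ∈ M.elem T := hk ▸ subset_convexHull ℝ _ (Set.mem_range_self k)
  rw [interp, Finset.sum_eq_single a]
  · rw [M.hat_eq_shape T _ hT, M.shape_self T k hk, if_pos rfl, mul_one]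
  · intro c _ hc
    rw [M.hat_eq_shape T _ hT, M.shape_self T k hk, if_neg (fun h => hc (Subtype.ext h)), mul_zero]
  · simp

theorem interp_sub [Finite ι] (M : Mesh ι d Ω) (w₁ w₂ : M.dof → ℝ) (x : E) :
    M.interp (w₁ - w₂) x = M.interp w₁ x - M.interp w₂ x := by
  simp [interp, sub_mul]

theorem hat_mem_space (M : Mesh ι d Ω) (a : M.dof) : M.hat a ∈ M.space :=
  Submodule.subset_span ⟨a, a.2, rfl⟩

/-- The integrand of the bilinear form of the linearized problem. -/
noncomputable def linearIntegrand [CompleteSpace E] (b : E → ℝ → ℝ) (u₁ u₂ f g : E → ℝ) (x : E) : ℝ :=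
  inner ℝ (gradient f x) (gradient g x) + meanDeriv b u₁ u₂ x * (f x * g x)

theorem linearIntegrand_symm [CompleteSpace E] (b : E → ℝ → ℝ) (u₁ u₂ f g : E → ℝ) (x : E) :
    linearIntegrand b u₁ u₂ f g x = linearIntegrand b u₁ u₂ g f x := by
  rw [linearIntegrand, linearIntegrand, real_inner_comm, mul_comm (f x)]

variable [FiniteDimensional ℝ E]

theorem continuous_interp [Finite ι] (M : Mesh ι d Ω) (w : M.dof → ℝ) :
    Continuous (M.interp w) :=
  continuous_finsetSum _ fun i _ => continuous_const.mul (M.continuous_hat i.2)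

section Measure

variable [MeasureSpace E] [BorelSpace E] [(volume : Measure E).IsAddHaarMeasure]

theorem integrableOn_meanDeriv_mul {M : Mesh ι d Ω} {b : E → ℝ → ℝ} {B : ℝ}
    {u₁ u₂ : E → ℝ} (hb : LowerOrderTerm Ω b B) (h₁ : Measurable u₁)
    (h₂ : Measurable u₂) (T : ι) {f : E → ℝ} (hf : Continuous f) :
    IntegrableOn (fun x => meanDeriv b u₁ u₂ x * f x) (M.elem T) := by
  have hm := (aemeasurable_meanDeriv hb.measurable hb.contDiff h₁ h₂).mono_measure
    (M.restrict_elem_le T)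
  refine Integrable.bdd_mul (c := B) (hf.continuousOn.integrableOn_compact (M.elem_isCompact T))
    hm.aestronglyMeasurable ?_
  have h := ae_mono (M.restrict_elem_le T) (hb.contDiff.and hb.deriv_mem)
  filter_upwards [h] with x hx
  rw [Real.norm_eq_abs, abs_of_nonneg (meanDeriv_nonneg (fun η => (hx.2 η).1) _ _)]
  exact meanDeriv_le hx.1 (fun η => (hx.2 η).2) _ _

end Measure

variable [CompleteSpace E]

theorem hasGradientAt_interp [Finite ι] (M : Mesh ι d Ω) (w : M.dof → ℝ) (T : ι) {x : E}
    (hx : x ∈ interior (M.elem T)) :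
    HasGradientAt (M.interp w) (∑ i : M.dof, w i • affineGradient (M.shape T i)) x := by
  rw [hasGradientAt_iff_hasFDerivAt, map_sum]
  refine (HasFDerivAt.fun_sum fun i (_ : i ∈ (Finset.univ : Finset M.dof)) =>
    ((M.hasGradientAt_hat T i hx).hasFDerivAt.const_mul (w i))).congr_fderiv ?_
  simp

theorem gradient_interp [Finite ι] (M : Mesh ι d Ω) (w : M.dof → ℝ) (T : ι) {x : E}
    (hx : x ∈ interior (M.elem T)) :
    gradient (M.interp w) x = ∑ i : M.dof, w i • gradient (M.hat i) x := by
  rw [(M.hasGradientAt_interp w T hx).gradient]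
  exact Finset.sum_congr rfl fun i _ => by rw [(M.hasGradientAt_hat T (i : E) hx).gradient]

/-- A finite element function whose gradient vanishes at one interior point of each simplex
vanishes identically. -/
theorem interp_eq_zero_of_gradient [Finite ι] [NoncompactSpace E] (M : Mesh ι d Ω)
    (w : M.dof → ℝ) (hw : ∀ T, ∃ x ∈ interior (M.elem T), gradient (M.interp w) x = 0) :
    M.interp w = 0 := by
  have hconst : ∀ T, ∃ c, ∀ x ∈ M.elem T, M.interp w x = c := by
    intro T
    obtain ⟨x, hx, hgx⟩ := hw T
    rw [(M.hasGradientAt_interp w T hx).gradient] at hgx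
    refine ⟨M.interp w x, fun y hy => ?_⟩
    have h : M.interp w y - M.interp w x = inner ℝ (∑ i : M.dof, w i •
        affineGradient (M.shape T i)) (y - x) := by
      rw [sum_inner, interp, interp, ← Finset.sum_sub_distrib]
      refine Finset.sum_congr rfl fun i _ => ?_
      rw [M.hat_eq_shape T _ hy, M.hat_eq_shape T _ (interior_subset hx), ← mul_sub,
        real_inner_smul_left, inner_affineGradient]
      congr 1
      exact ((M.shape T i).linearMap_vsub y x).symm
    rw [hgx, inner_zero_left] at h
    linarith
  choose c hc using hconst
  have hout : ∀ x ∉ Ω, M.interp w x = 0 := fun x hx =>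
    Finset.sum_eq_zero fun i _ => by rw [M.hat_eq_zero i.2 hx, mul_zero]
  -- Finitely many values and a connected domain force a continuous function to be constant. The
  -- constant is zero, since the compact set `closure Ω` cannot exhaust a noncompact space.
  have hfin : (Set.range (M.interp w)).Finite := by
    refine ((Set.finite_range c).insert 0).subset ?_
    rintro _ ⟨x, rfl⟩
    rcases M.mem_elem_or x with h | ⟨T, h⟩
    · exact Or.inl (hout x h)
    · exact Or.inr ⟨T, (hc T x h).symm⟩
  have hsub : (Set.range (M.interp w)).Subsingleton :=
    hfin.countable.isTotallyDisconnected _ le_rfl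
      (isPreconnected_range (M.continuous_interp w))
  have hcomp : IsCompact (closure Ω) := by
    rw [← M.iUnion_eq]
    exact isCompact_iUnion M.elem_isCompact
  obtain ⟨x₀, hx₀⟩ := (Set.ne_univ_iff_exists_notMem _).1 hcomp.ne_univ
  ext x
  rw [hsub ⟨x, rfl⟩ ⟨x₀, rfl⟩, hout x₀ fun h => hx₀ (subset_closure h)]
  rfl

section Measure

variable [MeasureSpace E] [BorelSpace E] [(volume : Measure E).IsAddHaarMeasure]

variable {M : Mesh ι d Ω} {b : E → ℝ → ℝ} {B : ℝ} {u₁ u₂ : E → ℝ}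

theorem integrableOn_inner_gradient (M : Mesh ι d Ω) (T : ι) (a c : E) :
    IntegrableOn (fun x => inner ℝ (gradient (M.hat a) x) (gradient (M.hat c) x)) (M.elem T) := by
  refine (integrableOn_const (C := inner ℝ (affineGradient (M.shape T a))
    (affineGradient (M.shape T c))) (M.elem_isCompact T).measure_lt_top.ne).congr ?_
  filter_upwards [M.ae_mem_interior T] with x hx
  rw [(M.hasGradientAt_hat T a hx).gradient, (M.hasGradientAt_hat T c hx).gradient]

theorem setIntegral_inner_gradient (M : Mesh ι d Ω) (T : ι) (a c : E) :
    ∫ x in M.elem T, inner ℝ (gradient (M.hat a) x) (gradient (M.hat c) x) =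
      volume.real (M.elem T) *
        inner ℝ (affineGradient (M.shape T a)) (affineGradient (M.shape T c)) := by
  rw [← smul_eq_mul, ← setIntegral_const]
  refine integral_congr_ae ?_
  filter_upwards [M.ae_mem_interior T] with x hx
  rw [(M.hasGradientAt_hat T a hx).gradient, (M.hasGradientAt_hat T c hx).gradient]

variable [Fintype ι]

theorem integrableOn_linearIntegrand_hat (hb : LowerOrderTerm Ω b B) (h₁ : Measurable u₁)
    (h₂ : Measurable u₂) (i j : M.dof) :
    IntegrableOn (linearIntegrand b u₁ u₂ (M.hat i) (M.hat j)) Ω :=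
  M.integrableOn_iff.2 fun T => (M.integrableOn_inner_gradient T i j).add
    (integrableOn_meanDeriv_mul hb h₁ h₂ T ((M.continuous_hat i.2).mul (M.continuous_hat j.2)))

/-- The element-by-element form, in which the off-diagonal signs are decided; the form as a single
integral over `Ω` serves definiteness and comparison. -/
theorem systemMatrix_apply_eq_sum (i j : M.dof) :
    M.systemMatrix b u₁ u₂ i j = ∑ T, (volume.real (M.elem T) *
        inner ℝ (affineGradient (M.shape T i)) (affineGradient (M.shape T j)) +
      ∫ x in M.elem T, meanDeriv b u₁ u₂ x * (M.hat i x * M.hat j x)) := by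
  rw [Finset.sum_add_distrib]
  simp only [systemMatrix, stiffness, mass, Matrix.add_apply, Matrix.of_apply]
  congr 1
  · exact Finset.sum_congr rfl fun T _ => M.setIntegral_inner_gradient T i j
  · refine Finset.sum_congr rfl fun T _ => integral_congr_ae (.of_forall fun x => ?_)
    simp only [intervalIntegral.integral_mul_const, meanDeriv, mul_assoc]

theorem systemMatrix_apply (hb : LowerOrderTerm Ω b B) (h₁ : Measurable u₁)
    (h₂ : Measurable u₂) (i j : M.dof) :
    M.systemMatrix b u₁ u₂ i j =
      ∫ x in Ω, linearIntegrand b u₁ u₂ (M.hat i) (M.hat j) x := by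
  rw [systemMatrix_apply_eq_sum,
    M.setIntegral_eq_sum (integrableOn_linearIntegrand_hat hb h₁ h₂ i j)]
  refine Finset.sum_congr rfl fun T _ => ?_
  rw [← setIntegral_inner_gradient]
  exact (integral_add (M.integrableOn_inner_gradient T i j) (integrableOn_meanDeriv_mul hb h₁ h₂ T
    ((M.continuous_hat i.2).mul (M.continuous_hat j.2)))).symm

theorem linearIntegrand_interp_right (f : E → ℝ) (w : M.dof → ℝ) :
    ∀ᵐ x ∂volume.restrict Ω, linearIntegrand b u₁ u₂ f (M.interp w) x =
      ∑ j : M.dof, linearIntegrand b u₁ u₂ f (M.hat j) x * w j := by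
  filter_upwards [M.ae_exists_mem_interior] with x ⟨T, hx⟩
  rw [linearIntegrand, M.gradient_interp w T hx, inner_sum, interp, Finset.mul_sum,
    Finset.mul_sum, ← Finset.sum_add_distrib]
  refine Finset.sum_congr rfl fun j _ => ?_
  rw [linearIntegrand, real_inner_smul_right]
  ring

theorem integrableOn_linearIntegrand_hat_interp (hb : LowerOrderTerm Ω b B) (h₁ : Measurable u₁)
    (h₂ : Measurable u₂) (i : M.dof) (w : M.dof → ℝ) :
    IntegrableOn (linearIntegrand b u₁ u₂ (M.hat i) (M.interp w)) Ω := by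
  refine Integrable.congr (integrable_finsetSum Finset.univ fun j _ =>
    (integrableOn_linearIntegrand_hat hb h₁ h₂ i j).mul_const (w j)) ?_
  filter_upwards [linearIntegrand_interp_right (M := M) (M.hat i) w] with x hx
  exact hx.symm

open Matrix in
theorem systemMatrix_mulVec (hb : LowerOrderTerm Ω b B) (h₁ : Measurable u₁)
    (h₂ : Measurable u₂) (w : M.dof → ℝ) (i : M.dof) :
    (M.systemMatrix b u₁ u₂ *ᵥ w) i =
      ∫ x in Ω, linearIntegrand b u₁ u₂ (M.hat i) (M.interp w) x := by
  rw [integral_congr_ae (linearIntegrand_interp_right (M.hat i) w),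
    integral_finsetSum _ fun j _ =>
      (integrableOn_linearIntegrand_hat hb h₁ h₂ i j).mul_const (w j)]
  refine Finset.sum_congr rfl fun j _ => ?_
  rw [integral_mul_const, ← systemMatrix_apply hb h₁ h₂]

theorem linearIntegrand_interp_self (w : M.dof → ℝ) :
    ∀ᵐ x ∂volume.restrict Ω, linearIntegrand b u₁ u₂ (M.interp w) (M.interp w) x =
      ∑ i : M.dof, w i * linearIntegrand b u₁ u₂ (M.hat i) (M.interp w) x := by
  filter_upwards [linearIntegrand_interp_right (b := b) (u₁ := u₁) (u₂ := u₂) (M.interp w) w]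
    with x hx
  rw [hx]
  refine Finset.sum_congr rfl fun i _ => ?_
  rw [linearIntegrand_symm, mul_comm]

open Matrix in
theorem dotProduct_systemMatrix_mulVec (hb : LowerOrderTerm Ω b B) (h₁ : Measurable u₁)
    (h₂ : Measurable u₂) (w : M.dof → ℝ) :
    w ⬝ᵥ (M.systemMatrix b u₁ u₂ *ᵥ w) =
      ∫ x in Ω, linearIntegrand b u₁ u₂ (M.interp w) (M.interp w) x := by
  rw [integral_congr_ae (linearIntegrand_interp_self w), integral_finsetSum _ fun i _ =>
      (integrableOn_linearIntegrand_hat_interp hb h₁ h₂ i w).const_mul (w i)]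
  refine Finset.sum_congr rfl fun i _ => ?_
  rw [integral_const_mul, ← systemMatrix_mulVec hb h₁ h₂]

theorem integrableOn_linearIntegrand_interp (hb : LowerOrderTerm Ω b B) (h₁ : Measurable u₁)
    (h₂ : Measurable u₂) (w : M.dof → ℝ) :
    IntegrableOn (linearIntegrand b u₁ u₂ (M.interp w) (M.interp w)) Ω := by
  refine Integrable.congr (integrable_finsetSum Finset.univ fun i _ =>
    (integrableOn_linearIntegrand_hat_interp hb h₁ h₂ i w).const_mul (w i)) ?_
  filter_upwards [linearIntegrand_interp_self (M := M) w] with x hx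
  exact hx.symm

theorem isSymm_systemMatrix (hb : LowerOrderTerm Ω b B) (h₁ : Measurable u₁)
    (h₂ : Measurable u₂) : (M.systemMatrix b u₁ u₂).IsSymm := by
  ext i j
  rw [Matrix.transpose_apply, systemMatrix_apply hb h₁ h₂, systemMatrix_apply hb h₁ h₂]
  exact integral_congr_ae (.of_forall fun x => linearIntegrand_symm _ _ _ _ _ x)

/-- The quadratic form is the integral of two nonnegative terms. If it is zero, the gradient
vanishes almost everywhere, which already forces the function to vanish, even where the averaged
derivative is zero. -/
theorem posDef_systemMatrix [NoncompactSpace E] (hb : LowerOrderTerm Ω b B)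
    (h₁ : Measurable u₁) (h₂ : Measurable u₂) : (M.systemMatrix b u₁ u₂).PosDef := by
  refine Matrix.PosDef.of_dotProduct_mulVec_pos ?_ fun w hw => ?_
  · rw [Matrix.IsHermitian, Matrix.conjTranspose_eq_transpose_of_trivial]
    exact isSymm_systemMatrix hb h₁ h₂
  rw [star_trivial, dotProduct_systemMatrix_mulVec hb h₁ h₂]
  have hc : ∀ᵐ x ∂volume.restrict Ω, 0 ≤ meanDeriv b u₁ u₂ x := by
    filter_upwards [hb.deriv_mem] with x hx
    exact meanDeriv_nonneg (fun η => (hx η).1) _ _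
  have h0 : 0 ≤ᵐ[volume.restrict Ω] linearIntegrand b u₁ u₂ (M.interp w) (M.interp w) := by
    filter_upwards [hc] with x hx
    exact add_nonneg real_inner_self_nonneg (mul_nonneg hx (mul_self_nonneg _))
  refine lt_of_le_of_ne (integral_nonneg_of_ae h0) fun heq => hw ?_
  have hz := (integral_eq_zero_iff_of_nonneg_ae h0
    (integrableOn_linearIntegrand_interp hb h₁ h₂ w)).1 heq.symm
  have hg : ∀ᵐ x ∂volume.restrict Ω, gradient (M.interp w) x = 0 := by
    filter_upwards [hc, hz] with x hx hzx
    have h3 : inner ℝ (gradient (M.interp w) x) (gradient (M.interp w) x) +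
      meanDeriv b u₁ u₂ x * (M.interp w x * M.interp w x) = 0 := hzx
    have h4 := mul_nonneg hx (mul_self_nonneg (M.interp w x))
    have h5 : (0 : ℝ) ≤ inner ℝ (gradient (M.interp w) x) (gradient (M.interp w) x) :=
      real_inner_self_nonneg
    exact (inner_self_eq_zero (𝕜 := ℝ)).1 (by linarith)
  -- The open simplex is nonempty and so has positive measure; an almost everywhere statement
  -- therefore holds at one of its points.
  have hv := M.interp_eq_zero_of_gradient w fun T => by
    have hT : ∀ᵐ x ∂volume.restrict (interior (M.elem T)), gradient (M.interp w) x = 0 :=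
      ae_mono (Measure.restrict_mono_set volume (M.interior_elem_subset T)) hg
    have hne : (interior (M.elem T)).Nonempty :=
      ⟨_, (M.cell T).centroid_mem_interior_convexHull⟩
    have hpos : volume.restrict (interior (M.elem T)) ≠ 0 := by
      rw [Ne, Measure.restrict_eq_zero]
      exact (isOpen_interior.measure_pos volume hne).ne'
    have : (ae (volume.restrict (interior (M.elem T)))).NeBot := ae_neBot.2 hpos
    obtain ⟨x, hx⟩ := (hT.and (ae_restrict_mem isOpen_interior.measurableSet)).exists
    exact ⟨x, hx.2, hx.1⟩
  ext a
  rw [← M.interp_vertex w a, hv]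
  rfl

/-- The condition on the simplex `T` that makes the local off-diagonal entries nonpositive. -/
def LocalCondition (M : Mesh ι d Ω) (B : ℝ) (T : ι) : Prop :=
  ∀ k l, k ≠ l → volume.real (M.elem T) * inner ℝ (affineGradient ((M.cell T).coord k))
    (affineGradient ((M.cell T).coord l)) +
    B * ∫ x in M.elem T, (M.cell T).coord k x * (M.cell T).coord l x ≤ 0

/-- A simplex contributes only if both nodes are among its vertices. There the product of the nodal
functions is nonnegative, so the worst coefficient is the constant `B`. -/
theorem systemMatrix_offDiag_nonpos (hb : LowerOrderTerm Ω b B) (h₁ : Measurable u₁)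
    (h₂ : Measurable u₂) (hloc : ∀ T, M.LocalCondition B T) {i j : M.dof} (hij : i ≠ j) :
    M.systemMatrix b u₁ u₂ i j ≤ 0 := by
  rw [systemMatrix_apply_eq_sum]
  refine Finset.sum_nonpos fun T _ => ?_
  by_cases hi : (i : E) ∈ Set.range (M.cell T)
  swap
  · have h : ∫ x in M.elem T, meanDeriv b u₁ u₂ x * (M.hat i x * M.hat j x) = 0 := by
      refine setIntegral_eq_zero_of_forall_eq_zero fun x hx => ?_
      rw [M.hat_of_notMem T hi hx, zero_mul, mul_zero]
    rw [h, M.shape_of_notMem T hi, affineGradient_zero]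
    simp
  by_cases hj : (j : E) ∈ Set.range (M.cell T)
  swap
  · have h : ∫ x in M.elem T, meanDeriv b u₁ u₂ x * (M.hat i x * M.hat j x) = 0 := by
      refine setIntegral_eq_zero_of_forall_eq_zero fun x hx => ?_
      rw [M.hat_of_notMem T hj hx, mul_zero, mul_zero]
    rw [h, M.shape_of_notMem T hj, affineGradient_zero]
    simp
  obtain ⟨k, hk⟩ := hi
  obtain ⟨l, hl⟩ := hj
  have hkl : k ≠ l := by
    rintro rfl
    exact hij (Subtype.ext (hk.symm.trans hl))
  refine le_trans (add_le_add ?_ ?_) (hloc T k l hkl)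
  · rw [← hk, ← hl, shape_vertex, shape_vertex]
  · rw [← integral_const_mul]
    have hcont := (M.continuous_hat i.2).mul (M.continuous_hat j.2)
    have hcont' : Continuous fun x => (M.cell T).coord k x * (M.cell T).coord l x :=
      ((M.cell T).coord k).continuous_of_finiteDimensional.mul
        ((M.cell T).coord l).continuous_of_finiteDimensional
    refine setIntegral_mono_ae_restrict (integrableOn_meanDeriv_mul hb h₁ h₂ T hcont)
      ((hcont'.continuousOn.integrableOn_compact (M.elem_isCompact T)).const_mul B) ?_
    have h := ae_mono (M.restrict_elem_le T) (hb.contDiff.and hb.deriv_mem)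
    filter_upwards [h, ae_restrict_mem (M.elem_isCompact T).measurableSet] with x hx hxT
    rw [← hk, ← hl, M.hat_vertex T k hxT, M.hat_vertex T l hxT]
    refine mul_le_mul_of_nonneg_right (meanDeriv_le hx.1 (fun η => (hx.2 η).2) _ _) ?_
    rw [← M.hat_vertex T k hxT, ← M.hat_vertex T l hxT]
    exact mul_nonneg (M.hat_nonneg _ _) (M.hat_nonneg _ _)

open Matrix in
/-- A discrete subsolution lies below a discrete supersolution if the matrix of the linearized
problem is a Stieltjes matrix. -/
theorem subsolution_le_supersolution (hb : LowerOrderTerm Ω b B) (h₁ : M.IsSubsolution b u₁)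
    (h₂ : M.IsSupersolution b u₂) (hA : IsStieltjes (M.systemMatrix b u₁ u₂)) (x : E) :
    u₁ x ≤ u₂ x := by
  obtain ⟨w₁, hw₁⟩ := M.exists_interp_of_mem_space h₁.1
  obtain ⟨w₂, hw₂⟩ := M.exists_interp_of_mem_space h₂.1
  have hm₁ : Measurable u₁ := hw₁ ▸ (M.continuous_interp w₁).measurable
  have hm₂ : Measurable u₂ := hw₂ ▸ (M.continuous_interp w₂).measurable
  -- Both weak inequalities are tested with the same nodal function; the difference of the two
  -- integrands is the linearized integrand for `u₂ - u₁`.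
  have key : ∀ i, 0 ≤ (M.systemMatrix b u₁ u₂ *ᵥ (w₂ - w₁)) i := by
    intro i
    obtain ⟨hi₁, hle₁⟩ := h₁.2 (M.hat i) (M.hat_mem_space i) fun x _ => M.hat_nonneg _ _
    obtain ⟨hi₂, hle₂⟩ := h₂.2 (M.hat i) (M.hat_mem_space i) fun x _ => M.hat_nonneg _ _
    rw [systemMatrix_mulVec hb hm₁ hm₂]
    have : ∫ x in Ω, linearIntegrand b u₁ u₂ (M.hat i) (M.interp (w₂ - w₁)) x =
        ∫ x in Ω, (weakIntegrand b u₂ (M.hat i) x - weakIntegrand b u₁ (M.hat i) x) := by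
      refine integral_congr_ae ?_
      filter_upwards [M.ae_exists_mem_interior, hb.contDiff] with x ⟨T, hx⟩ hcx
      have hg : gradient (M.interp (w₂ - w₁)) x = gradient u₂ x - gradient u₁ x := by
        rw [hw₁, hw₂, M.gradient_interp _ T hx, M.gradient_interp _ T hx,
          M.gradient_interp _ T hx, ← Finset.sum_sub_distrib]
        exact Finset.sum_congr rfl fun j _ => sub_smul _ _ _
      have hv : M.interp (w₂ - w₁) x = u₂ x - u₁ x := by rw [M.interp_sub, ← hw₁, ← hw₂]
      rw [linearIntegrand, weakIntegrand, weakIntegrand, hg, hv, inner_sub_right,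
        real_inner_comm, real_inner_comm (gradient u₁ x)]
      linear_combination (-M.hat i x) * meanDeriv_mul_sub hcx u₁ u₂
    rw [this, integral_sub hi₂ hi₁]
    linarith
  have hnn := hA.nonneg_of_mulVec_nonneg key
  have hs : 0 ≤ M.interp (w₂ - w₁) x :=
    Finset.sum_nonneg fun i _ => mul_nonneg (hnn i) (M.hat_nonneg _ _)
  rw [M.interp_sub, ← hw₁, ← hw₂] at hs
  linarith

theorem isStieltjes_and_comparison [NoncompactSpace E] [DecidableEq M.dof]
    (hb : LowerOrderTerm Ω b B) (h₁ : M.IsSubsolution b u₁) (h₂ : M.IsSupersolution b u₂)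
    (hloc : ∀ T, M.LocalCondition B T) :
    IsStieltjes (M.systemMatrix b u₁ u₂) ∧ (∀ i j, 0 ≤ (M.systemMatrix b u₁ u₂)⁻¹ i j) ∧
      ∀ x ∈ Ω, u₁ x ≤ u₂ x := by
  obtain ⟨w₁, hw₁⟩ := M.exists_interp_of_mem_space h₁.1
  obtain ⟨w₂, hw₂⟩ := M.exists_interp_of_mem_space h₂.1
  have hm₁ : Measurable u₁ := hw₁ ▸ (M.continuous_interp w₁).measurable
  have hm₂ : Measurable u₂ := hw₂ ▸ (M.continuous_interp w₂).measurable
  have hA : IsStieltjes (M.systemMatrix b u₁ u₂) :=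
    ⟨isSymm_systemMatrix hb hm₁ hm₂, posDef_systemMatrix hb hm₁ hm₂,
      fun i j hij => systemMatrix_offDiag_nonpos hb hm₁ hm₂ hloc hij⟩
  exact ⟨hA, hA.inv_nonneg, fun x _ => subsolution_le_supersolution hb h₁ h₂ hA x⟩

end Measure

end Mesh

/-! ### The local condition on an interval -/

theorem integral_Icc_mul_sub {p q : ℝ} (h : p ≤ q) :
    ∫ x in Set.Icc p q, (q - x) * (x - p) = (q - p) ^ 3 / 6 := by
  rw [integral_Icc_eq_integral_Ioc, ← intervalIntegral.integral_of_le h]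
  have hd : ∀ x : ℝ, HasDerivAt (fun x => -x ^ 3 / 3 + (p + q) * x ^ 2 / 2 - p * q * x)
      ((q - x) * (x - p)) x := by
    intro x
    have h1 := (((hasDerivAt_pow 3 x).neg.div_const 3).add
      (((hasDerivAt_pow 2 x).const_mul (p + q)).div_const 2)).sub
      ((hasDerivAt_id x).const_mul (p * q))
    convert! h1 using 1
    push_cast
    ring
  rw [intervalIntegral.integral_eq_sub_of_hasDerivAt (fun x _ => hd x)
    (Continuous.intervalIntegrable (by fun_prop) _ _)]
  ring

theorem coord_intervalCell {n : ℕ} (a : Fin (n + 1) → ℝ) (ha : StrictMono a) (k : Fin n) (x : ℝ) :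
    (intervalCell a ha k).coord 0 x = (a k.succ - x) / (a k.succ - a k.castSucc) ∧
    (intervalCell a ha k).coord 1 x = (x - a k.castSucc) / (a k.succ - a k.castSucc) := by
  have hlt : 0 < a k.succ - a k.castSucc := sub_pos.2 (ha k.castSucc_lt_succ)
  -- Affine functions are determined by their values at the two endpoints once `x` is written as a
  -- point on their line.
  have hx : x = AffineMap.lineMap (intervalCell a ha k 0) (intervalCell a ha k 1)
      ((x - a k.castSucc) / (a k.succ - a k.castSucc)) := by
    change x = AffineMap.lineMap (a k.castSucc) (a k.succ) _
    rw [AffineMap.lineMap_apply_ring']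
    field_simp
    ring
  constructor
  · conv_lhs => rw [hx]
    rw [AffineMap.apply_lineMap, AffineBasis.coord_apply_eq,
      AffineBasis.coord_apply_ne _ (by decide), AffineMap.lineMap_apply_ring']
    field_simp
    ring
  · conv_lhs => rw [hx]
    rw [AffineMap.apply_lineMap, AffineBasis.coord_apply_eq,
      AffineBasis.coord_apply_ne _ (by decide), AffineMap.lineMap_apply_ring']
    field_simp
    ring

theorem Mesh.affineGradient_real (f : ℝ →ᵃ[ℝ] ℝ) : Mesh.affineGradient f = f 1 - f 0 := by
  have h := Mesh.inner_affineGradient f 1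
  have h2 := f.linearMap_vsub 1 0
  simp at h h2
  rw [h, h2]

/-- With `s` the length of the interval, the slopes are `∓1/s` and the product of the coordinates
integrates to `s/6`. The local entry is thus at most zero exactly when `B s² ≤ 6`. -/
theorem localCondition_intervalMesh {n : ℕ} (a : Fin (n + 1) → ℝ) (ha : StrictMono a) {B : ℝ}
    (k : Fin n) (h : B * (a k.succ - a k.castSucc) ^ 2 ≤ 6) :
    (intervalMesh a ha).LocalCondition B k := by
  have hlt : 0 < a k.succ - a k.castSucc := sub_pos.2 (ha k.castSucc_lt_succ)
  have helem : (intervalMesh a ha).elem k = Set.Icc (a k.castSucc) (a k.succ) :=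
    convexHull_intervalCell a ha k
  have key : volume.real ((intervalMesh a ha).elem k) *
      inner ℝ (Mesh.affineGradient ((intervalCell a ha k).coord 0))
        (Mesh.affineGradient ((intervalCell a ha k).coord 1)) +
      B * ∫ x in (intervalMesh a ha).elem k,
        (intervalCell a ha k).coord 0 x * (intervalCell a ha k).coord 1 x ≤ 0 := by
    have hi : ∫ x in (intervalMesh a ha).elem k,
        (intervalCell a ha k).coord 0 x * (intervalCell a ha k).coord 1 x =
        (a k.succ - a k.castSucc) / 6 := by
      rw [helem]
      calc _ = ∫ x in Set.Icc (a k.castSucc) (a k.succ),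
            (a k.succ - x) * (x - a k.castSucc) / (a k.succ - a k.castSucc) ^ 2 := by
            refine integral_congr_ae (.of_forall fun x => ?_)
            simp only [(coord_intervalCell a ha k x).1, (coord_intervalCell a ha k x).2]
            field_simp
        _ = _ := by
            rw [integral_div, integral_Icc_mul_sub (ha k.castSucc_lt_succ).le]
            field_simp
    rw [hi, helem, Real.volume_real_Icc_of_le (ha k.castSucc_lt_succ).le,
      Mesh.affineGradient_real, Mesh.affineGradient_real, (coord_intervalCell a ha k 1).1,
      (coord_intervalCell a ha k 1).2, (coord_intervalCell a ha k 0).1,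
      (coord_intervalCell a ha k 0).2]
    simp only [RCLike.inner_apply, conj_trivial]
    set s := a k.succ - a k.castSucc
    have : s * (((1 - a k.castSucc) / s - (0 - a k.castSucc) / s) *
        ((a k.succ - 1) / s - (a k.succ - 0) / s)) + B * (s / 6) = (B * s ^ 2 - 6) / (6 * s) := by
      field_simp
      ring
    rw [this]
    exact div_nonpos_of_nonpos_of_nonneg (by linarith) (by positivity)
  intro i j hij
  change Fin 2 at i j
  fin_cases i <;> fin_cases j
  · exact absurd rfl hij
  · exact key
  · refine le_of_eq_of_le ?_ key
    rw [real_inner_comm]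
    simp only [mul_comm ((intervalCell a ha k).coord 0 _)]
    rfl
  · exact absurd rfl hij

/-! ### The local condition on a triangle -/

/-- The closed reference triangle. -/
def referenceTriangle : Set (ℝ × ℝ) := {p | 0 ≤ p.1 ∧ 0 ≤ p.2 ∧ p.1 + p.2 ≤ 1}

theorem isClosed_referenceTriangle : IsClosed referenceTriangle := by
  refine (isClosed_le continuous_const continuous_fst).inter
    ((isClosed_le continuous_const continuous_snd).inter
      (isClosed_le (continuous_fst.add continuous_snd) continuous_const))

theorem isCompact_referenceTriangle : IsCompact referenceTriangle := by
  refine (isCompact_Icc (a := ((0 : ℝ), (0 : ℝ))) (b := (1, 1))).of_isClosed_subset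
    isClosed_referenceTriangle ?_
  rintro ⟨s, t⟩ ⟨h1, h2, h3⟩
  simp only at h1 h2 h3
  exact ⟨⟨h1, h2⟩, ⟨by simp only; linarith, by simp only; linarith⟩⟩

theorem setIntegral_referenceTriangle {F : ℝ × ℝ → ℝ} (hF : Continuous F) :
    ∫ p in referenceTriangle, F p = ∫ s in (0 : ℝ)..1, ∫ t in (0 : ℝ)..(1 - s), F (s, t) := by
  have hm := isClosed_referenceTriangle.measurableSet
  have hint : Integrable (referenceTriangle.indicator F) (volume.prod volume) :=
    (integrable_indicator_iff hm).2
      (hF.continuousOn.integrableOn_compact isCompact_referenceTriangle)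
  rw [← integral_indicator hm, Measure.volume_eq_prod, integral_prod _ hint,
    intervalIntegral.integral_of_le zero_le_one, ← integral_Icc_eq_integral_Ioc,
    ← integral_indicator measurableSet_Icc]
  refine integral_congr_ae (.of_forall fun s => ?_)
  simp only
  by_cases hs : s ∈ Set.Icc (0 : ℝ) 1
  · rw [Set.indicator_of_mem hs, intervalIntegral.integral_of_le (by linarith [hs.2]),
      ← integral_Icc_eq_integral_Ioc, ← integral_indicator measurableSet_Icc]
    refine integral_congr_ae (.of_forall fun t => ?_)
    simp only [Set.indicator_apply, referenceTriangle, Set.mem_ofPred_eq, Set.mem_Icc]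
    refine if_congr ⟨fun h => ⟨h.2.1, by linarith [h.2.2]⟩,
      fun h => ⟨hs.1, h.1, by linarith [h.2]⟩⟩ rfl rfl
  · rw [Set.indicator_of_notMem hs]
    refine integral_eq_zero_of_ae (.of_forall fun t => Set.indicator_of_notMem ?_ _)
    rintro ⟨h1, h2, h3⟩
    simp only at h1 h2 h3
    exact hs ⟨h1, by linarith⟩

theorem setIntegral_referenceTriangle_one : ∫ _ in referenceTriangle, (1 : ℝ) = 1 / 2 := by
  rw [setIntegral_referenceTriangle (F := fun _ => (1 : ℝ)) continuous_const]
  simp only [integral_one, sub_zero]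
  rw [intervalIntegral.integral_sub intervalIntegrable_const intervalIntegral.intervalIntegrable_id,
    integral_one, integral_id]
  norm_num

theorem setIntegral_referenceTriangle_mul :
    ∫ p in referenceTriangle, p.1 * p.2 = 1 / 24 := by
  rw [setIntegral_referenceTriangle (F := fun p => p.1 * p.2) (by fun_prop)]
  have hinner : ∀ s : ℝ, ∫ t in (0 : ℝ)..(1 - s), s * t = s * (((1 - s) ^ 2 - 0 ^ 2) / 2) := by
    intro s
    rw [intervalIntegral.integral_const_mul, integral_id]
  simp only [hinner]
  have hd : ∀ x : ℝ, HasDerivAt (fun x : ℝ => x ^ 2 / 4 - x ^ 3 / 3 + x ^ 4 / 8)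
      (x * (((1 - x) ^ 2 - 0 ^ 2) / 2)) x := by
    intro x
    have h1 := (((hasDerivAt_pow 2 x).div_const 4).sub ((hasDerivAt_pow 3 x).div_const 3)).add
      ((hasDerivAt_pow 4 x).div_const 8)
    convert! h1 using 1
    push_cast
    ring
  rw [intervalIntegral.integral_eq_sub_of_hasDerivAt (fun x _ => hd x)
    (Continuous.intervalIntegrable (by fun_prop) _ _)]
  norm_num

/-- The plane as a product. -/
noncomputable def planeEquiv : EuclideanSpace ℝ (Fin 2) ≃ᵐ ℝ × ℝ :=
  (MeasurableEquiv.toLp 2 (Fin 2 → ℝ)).symm.trans MeasurableEquiv.finTwoArrow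

theorem planeEquiv_apply (y : EuclideanSpace ℝ (Fin 2)) : planeEquiv y = (y 0, y 1) := rfl

theorem measurePreserving_planeEquiv : MeasurePreserving planeEquiv :=
  (volume_preserving_finTwoArrow ℝ).comp
    (EuclideanSpace.volume_preserving_symm_measurableEquiv_toLp (Fin 2))

theorem sum_fin_three {α : Type*} [AddCommMonoid α] (g : Fin 3 → α) (k : Fin 3) :
    ∑ m, g m = g k + g (k + 1) + g (k + 2) := by
  fin_cases k
  · simp [Fin.sum_univ_three]
  · simp [Fin.sum_univ_three]
    abel
  · simp [Fin.sum_univ_three]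
    abel

section Triangle

variable (T : AffineBasis (Fin 3) ℝ (EuclideanSpace ℝ (Fin 2))) (k : Fin 3)

/-- The linear part of the affine map from the reference triangle onto `T` that sends the origin
to the vertex `k`. -/
noncomputable def edgeMap : EuclideanSpace ℝ (Fin 2) →L[ℝ] EuclideanSpace ℝ (Fin 2) :=
  LinearMap.toContinuousLinearMap
    { toFun := fun y => y 0 • (T (k + 1) - T k) + y 1 • (T (k + 2) - T k)
      map_add' := by
        intro x y
        simp only [PiLp.add_apply, add_smul]
        abel
      map_smul' := by
        intro c x
        simp only [PiLp.smul_apply, smul_eq_mul, RingHom.id_apply, smul_add, mul_smul] }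

theorem edgeMap_apply (y : EuclideanSpace ℝ (Fin 2)) :
    edgeMap T k y = y 0 • (T (k + 1) - T k) + y 1 • (T (k + 2) - T k) := rfl

/-- Twice the signed area of the triangle `T`. -/
noncomputable def edgeDet : ℝ :=
  (T (k + 1) - T k) 0 * (T (k + 2) - T k) 1 - (T (k + 1) - T k) 1 * (T (k + 2) - T k) 0

theorem det_edgeMap : (edgeMap T k).det = edgeDet T k := by
  rw [ContinuousLinearMap.det, ← LinearMap.det_toMatrix (EuclideanSpace.basisFun (Fin 2) ℝ).toBasis,
    Matrix.det_fin_two]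
  simp [LinearMap.toMatrix_apply, edgeMap_apply, edgeDet]
  ring

theorem coord_linear_sub (m l : Fin 3) :
    (T.coord m).linear (T l - T k) = T.coord m (T l) - T.coord m (T k) :=
  (T.coord m).linearMap_vsub (T l) (T k)

theorem coord_edgeMap (m : Fin 3) (y : EuclideanSpace ℝ (Fin 2)) :
    T.coord m (edgeMap T k y + T k) = y 0 * (T.coord m (T (k + 1)) - T.coord m (T k)) +
      y 1 * (T.coord m (T (k + 2)) - T.coord m (T k)) + T.coord m (T k) := by
  have h := (T.coord m).map_vadd (T k) (edgeMap T k y)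
  simp only [vadd_eq_add] at h
  rw [h, edgeMap_apply, map_add, map_smul, map_smul, coord_linear_sub, coord_linear_sub,
    smul_eq_mul, smul_eq_mul]

theorem fin_three_ne (k : Fin 3) : k ≠ k + 1 ∧ k ≠ k + 2 ∧ k + 1 ≠ k + 2 := by
  revert k
  decide

theorem coord_edgeMap_one (y : EuclideanSpace ℝ (Fin 2)) :
    T.coord (k + 1) (edgeMap T k y + T k) = y 0 := by
  obtain ⟨h1, h2, h3⟩ := fin_three_ne k
  rw [coord_edgeMap, T.coord_apply_eq, T.coord_apply_ne h1.symm, T.coord_apply_ne h3]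
  ring

theorem coord_edgeMap_two (y : EuclideanSpace ℝ (Fin 2)) :
    T.coord (k + 2) (edgeMap T k y + T k) = y 1 := by
  obtain ⟨h1, h2, h3⟩ := fin_three_ne k
  rw [coord_edgeMap, T.coord_apply_eq, T.coord_apply_ne h2.symm, T.coord_apply_ne h3.symm]
  ring

theorem coord_edgeMap_zero (y : EuclideanSpace ℝ (Fin 2)) :
    T.coord k (edgeMap T k y + T k) = 1 - y 0 - y 1 := by
  obtain ⟨h1, h2, h3⟩ := fin_three_ne k
  rw [coord_edgeMap, T.coord_apply_eq, T.coord_apply_ne h1, T.coord_apply_ne h2]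
  ring

/-- In the parameters `y` the barycentric coordinates are `1 - y 0 - y 1`, `y 0` and `y 1`, so their
nonnegativity is exactly the system of inequalities of the reference triangle. -/
theorem image_edgeMap :
    (fun y => edgeMap T k y + T k) '' (planeEquiv ⁻¹' referenceTriangle) =
      convexHull ℝ (Set.range T) := by
  rw [T.convexHull_eq_nonneg_coord]
  ext x
  constructor
  · rintro ⟨y, ⟨h0, h1, h2⟩, rfl⟩ m
    simp only [planeEquiv_apply] at h0 h1 h2
    have hm : m = k ∨ m = k + 1 ∨ m = k + 2 := by
      revert m k
      decide
    rcases hm with rfl | rfl | rfl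
    · rw [coord_edgeMap_zero]
      linarith
    · rwa [coord_edgeMap_one]
    · rwa [coord_edgeMap_two]
  · intro hx
    have hsum := T.sum_coord_apply_eq_one x
    have hcomb := T.linear_combination_coord_eq_self x
    rw [sum_fin_three _ k] at hsum hcomb
    refine ⟨WithLp.toLp 2 ![T.coord (k + 1) x, T.coord (k + 2) x], ⟨hx _, hx _, ?_⟩, ?_⟩
    · have := hx k
      simp only [planeEquiv_apply, Matrix.cons_val_zero, Matrix.cons_val_one]
      linarith
    · simp only [edgeMap_apply, Matrix.cons_val_zero, Matrix.cons_val_one]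
      conv_rhs => rw [← hcomb]
      have : T.coord k x = 1 - T.coord (k + 1) x - T.coord (k + 2) x := by linarith
      rw [this]
      module

/-- Change of variables with constant Jacobian `edgeDet T k`; the parametrization is injective
because two barycentric coordinates recover the parameters. -/
theorem setIntegral_triangle (g : EuclideanSpace ℝ (Fin 2) → ℝ) (F : ℝ × ℝ → ℝ)
    (hg : ∀ y, g (edgeMap T k y + T k) = F (planeEquiv y)) :
    ∫ x in convexHull ℝ (Set.range T), g x =
      |edgeDet T k| * ∫ p in referenceTriangle, F p := by
  have hm : MeasurableSet (planeEquiv ⁻¹' referenceTriangle) :=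
    planeEquiv.measurable isClosed_referenceTriangle.measurableSet
  have hinj : Set.InjOn (fun y => edgeMap T k y + T k) (planeEquiv ⁻¹' referenceTriangle) := by
    intro y _ z _ h
    simp only at h
    refine planeEquiv.injective ?_
    rw [planeEquiv_apply, planeEquiv_apply, ← coord_edgeMap_one T k y, ← coord_edgeMap_two T k y,
      h, coord_edgeMap_one, coord_edgeMap_two]
  rw [← image_edgeMap T k, integral_image_eq_integral_abs_det_fderiv_smul volume hm
    (fun y _ => ((edgeMap T k).hasFDerivAt.add_const (T k)).hasFDerivWithinAt) hinj]
  simp only [hg, smul_eq_mul, det_edgeMap]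
  rw [integral_const_mul, measurePreserving_planeEquiv.setIntegral_preimage_emb
    planeEquiv.measurableEmbedding]

theorem volume_real_triangle :
    volume.real (convexHull ℝ (Set.range T)) = |edgeDet T k| / 2 := by
  have := setIntegral_triangle T k (fun _ => 1) (fun _ => 1) fun _ => rfl
  rw [setIntegral_referenceTriangle_one, setIntegral_const, smul_eq_mul, mul_one] at this
  rw [this]
  ring

theorem setIntegral_coord_mul_coord :
    ∫ x in convexHull ℝ (Set.range T), T.coord (k + 1) x * T.coord (k + 2) x =
      |edgeDet T k| / 24 := by
  rw [setIntegral_triangle T k _ (fun p => p.1 * p.2) fun y => by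
    rw [coord_edgeMap_one, coord_edgeMap_two, planeEquiv_apply], setIntegral_referenceTriangle_mul]
  ring

theorem plane_inner (x y : EuclideanSpace ℝ (Fin 2)) : inner ℝ x y = x 0 * y 0 + x 1 * y 1 := by
  simp [PiLp.inner_apply, Fin.sum_univ_two, mul_comm]

/-- The two gradients form the dual basis of the edge vectors `v`, `w` issuing from vertex `k`. By
Cramer's rule, `D` times the gradients are `(w 1, -w 0)` and `(-v 1, v 0)`, the edges turned by a
right angle in opposite directions, whence the sign of the inner product. -/
theorem edgeDet_ne_zero_and_inner_affineGradient : edgeDet T k ≠ 0 ∧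
    inner ℝ (Mesh.affineGradient (T.coord (k + 1))) (Mesh.affineGradient (T.coord (k + 2))) *
      edgeDet T k ^ 2 = -inner ℝ (T (k + 1) - T k) (T (k + 2) - T k) := by
  obtain ⟨h1, h2, h3⟩ := fin_three_ne k
  have e1 := Mesh.inner_affineGradient (T.coord (k + 1)) (T (k + 1) - T k)
  have e2 := Mesh.inner_affineGradient (T.coord (k + 1)) (T (k + 2) - T k)
  have e3 := Mesh.inner_affineGradient (T.coord (k + 2)) (T (k + 1) - T k)
  have e4 := Mesh.inner_affineGradient (T.coord (k + 2)) (T (k + 2) - T k)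
  rw [coord_linear_sub, T.coord_apply_eq, T.coord_apply_ne h1.symm, plane_inner] at e1
  rw [coord_linear_sub, T.coord_apply_ne h3, T.coord_apply_ne h1.symm, plane_inner] at e2
  rw [coord_linear_sub, T.coord_apply_ne h3.symm, T.coord_apply_ne h2.symm, plane_inner] at e3
  rw [coord_linear_sub, T.coord_apply_eq, T.coord_apply_ne h2.symm, plane_inner] at e4
  rw [plane_inner, plane_inner, edgeDet]
  generalize Mesh.affineGradient (T.coord (k + 1)) = g at *
  generalize Mesh.affineGradient (T.coord (k + 2)) = f at *
  generalize T (k + 1) - T k = v at *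
  generalize T (k + 2) - T k = w at *
  set D := v 0 * w 1 - v 1 * w 0 with hD
  have g0 : g 0 * D = w 1 := by linear_combination w 1 * e1 - v 1 * e2
  have g1 : g 1 * D = -w 0 := by linear_combination -w 0 * e1 + v 0 * e2
  have f0 : f 0 * D = -v 1 := by linear_combination w 1 * e3 - v 1 * e4
  have f1 : f 1 * D = v 0 := by linear_combination -w 0 * e3 + v 0 * e4
  -- If `D = 0`, the Cramer identities give `w = 0`, contradicting that the coordinate of vertex `k
  -- + 2` increases by one along `w`.
  refine ⟨fun h => ?_, ?_⟩
  · rw [h, mul_zero] at g0 g1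
    rw [← g0, neg_eq_zero.1 g1.symm] at e4
    norm_num at e4
  · calc _ = (g 0 * D) * (f 0 * D) + (g 1 * D) * (f 1 * D) := by ring
      _ = _ := by rw [g0, g1, f0, f1]; ring

/-- By Lagrange's identity `|v|²|w|² - (v · w)² = D²`, the sine of the angle times the edge lengths
is `|D|`, while the cosine times the same lengths is `v · w`. -/
theorem cot_triangleAngle : Real.cot (triangleAngle T k) =
    inner ℝ (T (k + 1) - T k) (T (k + 2) - T k) / |edgeDet T k| := by
  have hsin := InnerProductGeometry.sin_angle_mul_norm_mul_norm (T (k + 1) - T k) (T (k + 2) - T k)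
  have hcos := InnerProductGeometry.cos_angle_mul_norm_mul_norm (T (k + 1) - T k) (T (k + 2) - T k)
  have hD : inner ℝ (T (k + 1) - T k) (T (k + 1) - T k) *
      inner ℝ (T (k + 2) - T k) (T (k + 2) - T k) -
      inner ℝ (T (k + 1) - T k) (T (k + 2) - T k) * inner ℝ (T (k + 1) - T k) (T (k + 2) - T k) =
      edgeDet T k ^ 2 := by
    simp only [plane_inner, edgeDet]
    ring
  rw [hD, Real.sqrt_sq_eq_abs] at hsin
  have hne : ‖T (k + 1) - T k‖ * ‖T (k + 2) - T k‖ ≠ 0 := by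
    intro h
    rw [h, mul_zero] at hsin
    exact (edgeDet_ne_zero_and_inner_affineGradient T k).1 (abs_eq_zero.1 hsin.symm)
  rw [Real.cot_eq_cos_div_sin, ← hsin, ← hcos, mul_div_mul_right _ _ hne]
  rfl

/-- With `|T| = D/2`, gradient product `-c/D²` and `cot θ = c/D`, the local entry is `-cot θ / 2 + B
|T| / 12`. The integral `D/24` of the product of coordinates is what produces the constant 6. -/
theorem local_condition_triangle {B : ℝ}
    (h : B * volume.real (convexHull ℝ (Set.range T)) ≤ 6 * Real.cot (triangleAngle T k)) :
    volume.real (convexHull ℝ (Set.range T)) *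
      inner ℝ (Mesh.affineGradient (T.coord (k + 1))) (Mesh.affineGradient (T.coord (k + 2))) +
      B * ∫ x in convexHull ℝ (Set.range T), T.coord (k + 1) x * T.coord (k + 2) x ≤ 0 := by
  obtain ⟨hne, hin⟩ := edgeDet_ne_zero_and_inner_affineGradient T k
  rw [cot_triangleAngle] at h
  rw [setIntegral_coord_mul_coord]
  rw [volume_real_triangle T k] at h ⊢
  rw [← sq_abs] at hin
  have hpos := abs_pos.2 hne
  generalize |edgeDet T k| = D at *
  rw [eq_div_of_mul_eq (by positivity) hin]
  generalize (inner ℝ (T (k + 1) - T k) (T (k + 2) - T k) : ℝ) = c at *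
  have : D / 2 * (-c / D ^ 2) + B * (D / 24) = (B * (D / 2) - 6 * (c / D)) / 12 := by
    field_simp
    ring
  rw [this]
  linarith

end Triangle

theorem localCondition_of_cot {ι : Type*} {Ω : Set (EuclideanSpace ℝ (Fin 2))} (M : Mesh ι 2 Ω)
    {B : ℝ} (T : ι)
    (h : ∀ k, B * volume.real (M.elem T) ≤ 6 * Real.cot (triangleAngle (M.cell T) k)) :
    M.LocalCondition B T := by
  intro i j hij
  change Fin 3 at i j
  -- `k` is the third vertex, opposite the edge joining `i` and `j`; its angle is the one that
  -- governs this entry.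
  have hk : ∃ k : Fin 3, (i = k + 1 ∧ j = k + 2) ∨ (i = k + 2 ∧ j = k + 1) := by
    revert i j
    decide
  obtain ⟨k, ⟨rfl, rfl⟩ | ⟨rfl, rfl⟩⟩ := hk
  · exact local_condition_triangle (M.cell T) k (h k)
  · refine le_of_eq_of_le ?_ (local_condition_triangle (M.cell T) k (h k))
    rw [real_inner_comm]
    simp only [mul_comm ((M.cell T).coord (k + 1) _)]
    rfl

open Classical in
theorem theorem5p2 :
    -- one dimension
    (∀ (n : ℕ) (a : Fin (n + 1) → ℝ) (ha : StrictMono a) (b : ℝ → ℝ → ℝ) (Bη : ℝ)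
      (u₁ u₂ : ℝ → ℝ),
      LowerOrderTerm (Set.Ioo (a 0) (a (Fin.last n))) b Bη →
      (intervalMesh a ha).IsSubsolution b u₁ →
      (intervalMesh a ha).IsSupersolution b u₂ →
      (∀ k : Fin n, Bη * (a k.succ - a k.castSucc) ^ 2 ≤ 6) →
      IsStieltjes ((intervalMesh a ha).systemMatrix b u₁ u₂) ∧
      (∀ i j, 0 ≤ ((intervalMesh a ha).systemMatrix b u₁ u₂)⁻¹ i j) ∧
      ∀ x ∈ Set.Ioo (a 0) (a (Fin.last n)), u₁ x ≤ u₂ x) ∧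
    -- two dimensions
    (∀ (ι : Type) [Fintype ι] (Ω : Set (EuclideanSpace ℝ (Fin 2))) (M : Mesh ι 2 Ω)
      (b : EuclideanSpace ℝ (Fin 2) → ℝ → ℝ) (Bη : ℝ) (u₁ u₂ : EuclideanSpace ℝ (Fin 2) → ℝ),
      MeshRegular M →
      LowerOrderTerm Ω b Bη →
      M.IsSubsolution b u₁ →
      M.IsSupersolution b u₂ →
      (∀ T k, Bη * volume.real (M.elem T) ≤ 6 * Real.cot (triangleAngle (M.cell T) k)) →
      IsStieltjes (M.systemMatrix b u₁ u₂) ∧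
      (∀ i j, 0 ≤ (M.systemMatrix b u₁ u₂)⁻¹ i j) ∧
      ∀ x ∈ Ω, u₁ x ≤ u₂ x) := by

  refine ⟨fun n a ha b Bη u₁ u₂ hb h₁ h₂ h => ?_, fun ι _ Ω M b Bη u₁ u₂ _ hb h₁ h₂ h => ?_⟩
  · exact Mesh.isStieltjes_and_comparison hb h₁ h₂ fun k => localCondition_intervalMesh a ha k (h k)
  · exact Mesh.isStieltjes_and_comparison hb h₁ h₂ fun T => localCondition_of_cot M T (h T)
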